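/- **Setting.** Spaces are locally compact and Polish. Let $X$ be a compact minimal foliated space (all leaves dense) with a regular foliated atlas $\{U_i,\xi_i:U_i\to B_i\times T_i\}$, where $B_i\subset\mathbb R^n$ is open and contractible. Let $p_i:U_i\to T_i$ be the projections, $h_{ij}:p_j(U_i\cap U_j)\to p_i(U_i\cap U_j)$ the elementary holonomy transformations ($h_{ij}p_j=p_i$), and $\mathcal H$ the pseudogroup on $T=\bigsqcup_iT_i$ generated by the $h_{ij}$. Let $S\subset\mathcal H$ generate $\mathcal H$, with $S^2\subset S=S^{-1}$, so that $\mathcal H$ is equicontinuous and strongly quasi-analytic with respect to $S$. Let $\overline S$ be the set of local transformations $g$ of $T$ that belong to the compact-open closure of $C(\operatorname{dom}g,T)\cap S_{\mathrm{loc}}$, where $S_{\mathrm{loc}}$ is the set of restrictions of elements of $S$ to open sets, and let $\overline{\mathcal H}$ be the pseudogroup generated by $\overline S$. Assume that $\overline{\mathcal H}$ is strongly quasi-analytic. Let $\widehat T$ be the set of germs $\boldsymbol\gamma(g,u)$ of maps in $\overline{\mathcal H}$, with the final topology given by the germ map $\{(g,u)\in\overline S\times T\mid u\in\operatorname{dom}g\}\to\widehat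 T$, where $\overline S$ has the compact-open topology of partial maps. Fix $x_0\in U_{i_0}$ and $u_0=p_{i_0}(x_0)$. Let $\widehat T_0\subset\widehat T$ be the subspace of germs at $u_0$, let $\hat\pi_0:\widehat T_0\to T$ be the target map, and let $$H=\{\boldsymbol\gamma(g,u_0)\mid g\in\overline{\mathcal H},\ u_0\in\operatorname{dom}g,\ g(u_0)=u_0\},$$ a group with the germ product. Let $\widehat X_0$ be the quotient of $\bigsqcup_i\{(x,\gamma)\in U_i\times\widehat T_0\mid p_i(x)=\hat\pi_0(\gamma)\}$ by the relation $(x,\gamma,i)\sim(x,\boldsymbol\gamma(h_{ji},p_i(x))\,\gamma,j)$ for $x\in U_i\cap U_j$. Let $[x,\gamma,i]$ be the class of $(x,\gamma,i)$, and let $\hat\pi_0:\widehat X_0\to X$, $[x,\gamma,i]\mapsto x$. The space $\widehat X_0$ is foliated by the plaques $\{[x,\gamma,i]\mid p_i(x)=\hat\pi_0(\gamma)\}$, for $\gamma$ and $i$ fixed, and $H$ acts on it on the right by $[x,\gamma,i]\cdot\sigma=[x,\gamma\sigma,i]$. Let $\widehat L_{\hat x}$ be the leaf of $\widehat X_0$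 through $\hat x$, and $L_x$ the leaf of $X$ through $x$. For $x\in U_i$, let $\operatorname{Hol}(L_x,x)$ be the group of germs at $p_i(x)$ of the $h\in\mathcal H$ with $h(p_i(x))=p_i(x)$. The homomorphism $\operatorname{hol}:\pi_1(L_x,x)\to\operatorname{Hol}(L_x,x)$ sends $[c]$ to the germ at $p_i(x)$ of the inverse of the holonomy transformation along $c$. The holonomy covering $\widetilde L^{\mathrm{hol}}_x$ is the covering of $L_x$ defined by $\ker\operatorname{hol}$; it consists of classes $[c']$ of paths $c'$ in $L_x$ from $x$, and $\operatorname{Hol}(L_x,x)$ acts on it on the right by $[c']\cdot\operatorname{hol}([c])=[c^{-1}c']$. **Proposition.** 1. Let $\hat x_0=[x_0,\boldsymbol\gamma(\operatorname{id},u_0),i_0]$. Then $\operatorname{Hol}(L_{x_0},x_0)\subset H$ and $$\operatorname{Hol}(L_{x_0},x_0)=\{\sigma\in H\mid\widehat L_{\hat x_0}\cdot\sigma=\widehat L_{\hat x_0}\}.$$ The action of $\operatorname{Hol}(L_{x_0},x_0)$ on $\widetilde L^{\mathrm{hol}}_{x_0}$ is well defined. There is a homeomorphism $\widetilde L^{\mathrm{hol}}_{x_0}\to\widehat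 L_{\hat x_0}$ (leaf topology) over $X$ that sends the base point to $\hat x_0$, and its composite with $\widehat L_{\hat x_0}\hookrightarrow\widehat X_0$ is equivariant with respect to $\operatorname{Hol}(L_{x_0},x_0)\hookrightarrow H$. 2. For all $i$ and $x\in U_i$, there is some germ $\gamma\in\widehat T_0$ with $\hat\pi_0(\gamma)=p_i(x)$. For every such $\gamma$ and $\hat x=[x,\gamma,i]$, the map $\kappa\mapsto\gamma^{-1}\kappa\gamma$ is an injective homomorphism $\operatorname{Hol}(L_x,x)\to H$ with image $\{\sigma\in H\mid\widehat L_{\hat x}\cdot\sigma=\widehat L_{\hat x}\}$. The action of $\operatorname{Hol}(L_x,x)$ on $\widetilde L^{\mathrm{hol}}_x$ is well defined, there is a homeomorphism $\widetilde L^{\mathrm{hol}}_x\to\widehat L_{\hat x}$ over $X$ sending the base point to $\hat x$, and its composite with $\widehat L_{\hat x}\hookrightarrow\widehat X_0$ is equivariant with respect to this homomorphism. In particular, $H$ contains a copy of the holonomy group of every leaf. -/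

import Mathlib

open Set Topology Filter

namespace Molino

universe u v w

/-! ### Pseudogroups

A local transformation of `T` is an `OpenPartialHomeomorph T T` (only its values on `source`
matter).  A pseudogroup is a `StructureGroupoid` that is closed under restriction to open sets. -/

section Pseudogroups

variable {T : Type u} [TopologicalSpace T]

/-- The pseudogroup generated by a set `S` of local transformations: the smallest one that
contains `S`. -/
def generatedBy (S : Set (OpenPartialHomeomorph T T)) : StructureGroupoid T :=
  sInf {G | ClosedUnderRestriction G ∧ S ⊆ G.members}

theorem subset_generatedBy (S : Set (OpenPartialHomeomorph T T))
    {g : OpenPartialHomeomorph T T} (hg : g ∈ S) : g ∈ generatedBy S := by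
  refine mem_iInter₂.2 fun G hG => hG.2 hg

theorem generatedBy_mono {S S' : Set (OpenPartialHomeomorph T T)} (h : S ⊆ S') :
    generatedBy S ≤ generatedBy S' := by
  intro g hg
  exact mem_iInter₂.2 fun G hG => mem_iInter₂.1 hg G ⟨hG.1, h.trans hG.2⟩

/-- A subset `S` with `S² ⊆ S = S⁻¹` that generates the pseudogroup `G`. -/
structure GeneratingSet (G : StructureGroupoid T) where
  carrier : Set (OpenPartialHomeomorph T T)
  symm_mem : ∀ g ∈ carrier, g.symm ∈ carrier
  trans_mem : ∀ g ∈ carrier, ∀ h ∈ carrier, g.trans h ∈ carrier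
  generates : generatedBy carrier = G

/-- (Strong) equicontinuity with respect to `S`: there are an open cover `V` of `T` and metrics
`d k` inducing the topology of every `V k` for which the maps in `S` are uniformly
equicontinuous. -/
def IsEquicontinuous (S : Set (OpenPartialHomeomorph T T)) : Prop :=
  ∃ (κ : Type u) (V : κ → Set T) (d : ∀ k, MetricSpace (V k)),
    (∀ k, IsOpen (V k)) ∧ (⋃ k, V k) = univ ∧
    (∀ k, (d k).toPseudoMetricSpace.toUniformSpace.toTopologicalSpace =
      (instTopologicalSpaceSubtype : TopologicalSpace (V k))) ∧
    ∀ ε : ℝ, 0 < ε → ∃ δ : ℝ, 0 < δ ∧ ∀ h ∈ S, ∀ (k l : κ) (x y : V k),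
      (x : T) ∈ h.source → (y : T) ∈ h.source →
      ∀ (hx : h x ∈ V l) (hy : h y ∈ V l),
        (d k).dist x y < δ → (d l).dist ⟨h x, hx⟩ ⟨h y, hy⟩ < ε

/-- Strong quasi-analyticity with respect to `S`: a map in `S` that is the identity on some
non-empty open subset of its domain is the identity on its domain. -/
def IsQuasiAnalytic (S : Set (OpenPartialHomeomorph T T)) : Prop :=
  ∀ h ∈ S, ∀ O : Set T, IsOpen O → O.Nonempty → O ⊆ h.source → EqOn h id O →
    EqOn h id h.source

/-- A pseudogroup is strongly quasi-analytic when some generating set `S`, with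
`S² ⊆ S = S⁻¹`, is. -/
def StronglyQuasiAnalytic (G : StructureGroupoid T) : Prop :=
  ∃ S : GeneratingSet G, IsQuasiAnalytic S.carrier

/-- A local transformation as a continuous map on its domain. -/
def toContinuousMap (g : OpenPartialHomeomorph T T) : C(g.source, T) :=
  ⟨g.source.domRestrict g, g.continuousOn.domRestrict⟩

/-- The set `S̄`: the local transformations `g`, with open domain `O`, that belong to the closure
of `C(O, T) ∩ S_loc` in `C(O, T)` with the compact-open topology, where `S_loc` consists of the
restrictions of the elements of `S` to open sets. -/
def closureSet (S : Set (OpenPartialHomeomorph T T)) : Set (OpenPartialHomeomorph T T) :=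
  {g | toContinuousMap g ∈ closure {f : C(g.source, T) | ∃ s ∈ S, g.source ⊆ s.source ∧
    ∀ x : g.source, f x = s x}}

theorem subset_closureSet (S : Set (OpenPartialHomeomorph T T)) : S ⊆ closureSet S := by
  intro g hg
  exact subset_closure ⟨g, hg, Subset.rfl, fun _ => rfl⟩

/-- The closure of the pseudogroup generated by `S`. -/
def closurePseudogroup (S : Set (OpenPartialHomeomorph T T)) : StructureGroupoid T :=
  generatedBy (closureSet S)

/-- The compact-open topology on partial maps, restricted to `S̄`; it is generated by the sets
of all `g` with `K ⊆ dom g` and `g(K) ⊆ O`, for `K` compact and `O` open. -/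
instance closureSetTopology (S : Set (OpenPartialHomeomorph T T)) :
    TopologicalSpace (closureSet S) :=
  TopologicalSpace.generateFrom
    {N | ∃ K O : Set T, IsCompact K ∧ IsOpen O ∧
      N = {g | K ⊆ g.1.source ∧ g.1 '' K ⊆ O}}

/-! ### Germs -/

/-- Elements of `G` defined at `x` that map `x` to `y`. -/
def LocalRep (G : StructureGroupoid T) (x y : T) : Type u :=
  {g : OpenPartialHomeomorph T T // g ∈ G ∧ x ∈ g.source ∧ g x = y}

instance germSetoid (G : StructureGroupoid T) (x y : T) : Setoid (LocalRep G x y) where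
  r g h := (g.1 : T → T) =ᶠ[𝓝 x] h.1
  iseqv := ⟨fun _ => EventuallyEq.rfl, fun h => h.symm, fun h h' => h.trans h'⟩

theorem LocalRep.mem_target {G : StructureGroupoid T} {x y : T} (g : LocalRep G x y) :
    y ∈ g.1.target := by
  have h := g.1.map_source g.2.2.1
  rwa [g.2.2.2] at h

theorem LocalRep.symm_apply {G : StructureGroupoid T} {x y : T} (g : LocalRep G x y) :
    g.1.symm y = x := by
  have h := g.1.left_inv g.2.2.1
  rwa [g.2.2.2] at h

/-- The germs at `x` of maps `g ∈ G` with `x ∈ dom g` and `g x = y`. -/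
def GermHom (G : StructureGroupoid T) (x y : T) : Type u :=
  Quotient (germSetoid G x y)

/-- The germ `γ(g, x)`. -/
def germ {G : StructureGroupoid T} {x y : T} (g : OpenPartialHomeomorph T T) (hg : g ∈ G)
    (hx : x ∈ g.source) (hy : g x = y) : GermHom G x y :=
  Quotient.mk _ ⟨g, hg, hx, hy⟩

namespace GermHom

variable {G : StructureGroupoid T} {x y z t : T}

/-- The germ of the identity. -/
def one (G : StructureGroupoid T) (x : T) : GermHom G x x :=
  germ (OpenPartialHomeomorph.refl T) G.id_mem (mem_univ x) rfl

/-- The germ product `b a` (first `a`, then `b`). -/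
def comp (b : GermHom G y z) (a : GermHom G x y) : GermHom G x z :=
  Quotient.map₂
    (fun (h : LocalRep G y z) (g : LocalRep G x y) =>
      (⟨g.1.trans h.1, G.trans g.2.1 h.2.1, by
        rw [OpenPartialHomeomorph.trans_source]
        refine ⟨g.2.2.1, ?_⟩
        rw [mem_preimage, g.2.2.2]
        exact h.2.2.1, by
        rw [OpenPartialHomeomorph.coe_trans, Function.comp_apply, g.2.2.2, h.2.2.2]⟩ :
        LocalRep G x z))
    (by
      intro h h' hh g g' hg
      have hh : (h.1 : T → T) =ᶠ[𝓝 y] h'.1 := hh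
      have hg : (g.1 : T → T) =ᶠ[𝓝 x] g'.1 := hg
      have hc : Tendsto g.1 (𝓝 x) (𝓝 y) := by
        have := (g.1.continuousAt g.2.2.1).tendsto
        rwa [g.2.2.2] at this
      change (g.1.trans h.1 : T → T) =ᶠ[𝓝 x] g'.1.trans h'.1
      filter_upwards [hc.eventually hh, hg] with p hp hp'
      simp only [OpenPartialHomeomorph.coe_trans, Function.comp_apply]
      rw [hp, hp']) b a

/-- The inverse germ. -/
def inv (a : GermHom G x y) : GermHom G y x :=
  Quotient.map
    (fun (g : LocalRep G x y) =>
      (⟨g.1.symm, G.symm g.2.1, g.mem_target, g.symm_apply⟩ : LocalRep G y x))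
    (by
      intro g g' hg
      have hg : (g.1 : T → T) =ᶠ[𝓝 x] g'.1 := hg
      have hy : y ∈ g.1.target := g.mem_target
      have hx : g.1.symm y = x := g.symm_apply
      have hc : Tendsto g.1.symm (𝓝 y) (𝓝 x) := by
        have := (g.1.continuousAt_symm hy).tendsto
        rwa [hx] at this
      change (g.1.symm : T → T) =ᶠ[𝓝 y] g'.1.symm
      filter_upwards [hc.eventually hg, hc.eventually (g'.1.open_source.mem_nhds g'.2.2.1),
        g.1.open_target.mem_nhds hy] with p hp hp' hp''
      rw [g.1.right_inv hp''] at hp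
      rw [hp, g'.1.left_inv hp', ← hp]) a

theorem comp_assoc (c : GermHom G z t) (b : GermHom G y z) (a : GermHom G x y) :
    comp (comp c b) a = comp c (comp b a) := by
  induction a using Quotient.inductionOn
  induction b using Quotient.inductionOn
  induction c using Quotient.inductionOn
  exact Quotient.sound (EventuallyEq.of_eq rfl)

theorem one_comp (a : GermHom G x y) : comp (one G y) a = a := by
  induction a using Quotient.inductionOn
  exact Quotient.sound (EventuallyEq.of_eq rfl)

theorem comp_one (a : GermHom G x y) : comp a (one G x) = a := by
  induction a using Quotient.inductionOn
  exact Quotient.sound (EventuallyEq.of_eq rfl)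

theorem inv_comp (a : GermHom G x y) : comp (inv a) a = one G x := by
  induction a using Quotient.inductionOn with
  | h g => exact Quotient.sound (g.1.eventually_left_inverse g.2.2.1)

theorem comp_inv (a : GermHom G x y) : comp a (inv a) = one G y := by
  induction a using Quotient.inductionOn with
  | h g =>
    exact Quotient.sound (g.1.eventually_right_inverse g.mem_target)

/-- The group of germs at `x` of elements of `G` that fix `x`, with the germ product. -/
instance group (G : StructureGroupoid T) (x : T) : Group (GermHom G x x) where
  mul := comp
  one := one G x
  inv := inv
  mul_assoc := comp_assoc
  one_mul := one_comp
  mul_one := comp_one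
  inv_mul_cancel := inv_comp

/-- The inclusion of germs induced by an inclusion of pseudogroups. -/
def incl {G G' : StructureGroupoid T} (hG : G ≤ G') (a : GermHom G x y) : GermHom G' x y :=
  Quotient.map (fun g : LocalRep G x y => (⟨g.1, hG g.2.1, g.2.2⟩ : LocalRep G' x y))
    (fun _ _ h => h) a

theorem incl_comp {G G' : StructureGroupoid T} (hG : G ≤ G') (b : GermHom G y z)
    (a : GermHom G x y) : incl hG (comp b a) = comp (incl hG b) (incl hG a) := by
  induction a using Quotient.inductionOn
  induction b using Quotient.inductionOn
  rfl

/-- The inclusion homomorphism of germ groups at a point. -/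
def inclHom {G G' : StructureGroupoid T} (hG : G ≤ G') (x : T) :
    GermHom G x x →* GermHom G' x x :=
  MonoidHom.mk' (incl hG) (incl_comp hG)

/-- Conjugation by a germ `a` from `x` to `y`: the homomorphism `κ ↦ a⁻¹ κ a`. -/
def conjHom (a : GermHom G x y) : GermHom G y y →* GermHom G x x :=
  MonoidHom.mk' (fun κ => comp (inv a) (comp κ a)) (by
    intro κ κ'
    change comp (inv a) (comp (comp κ κ') a) =
      comp (comp (inv a) (comp κ a)) (comp (inv a) (comp κ' a))
    rw [comp_assoc (inv a) (comp κ a), comp_assoc κ a, ← comp_assoc a (inv a), comp_inv,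
      one_comp, comp_assoc κ κ'])

end GermHom

/-- The set `T̂` of all germs of maps in the closure of the pseudogroup generated by `S`. -/
def GermSpace (S : Set (OpenPartialHomeomorph T T)) : Type u :=
  Σ x : T, Σ y : T, GermHom (closurePseudogroup S) x y

/-- The germ map `S̄ * T → T̂`, `(g, x) ↦ γ(g, x)`. -/
def germMap (S : Set (OpenPartialHomeomorph T T))
    (q : {q : closureSet S × T // q.2 ∈ q.1.1.source}) : GermSpace S :=
  ⟨q.1.2, q.1.1.1 q.1.2, germ q.1.1.1 (subset_generatedBy _ q.1.1.2) q.2 rfl⟩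

/-- `T̂` has the final topology induced by the germ map. -/
instance germSpaceTopology (S : Set (OpenPartialHomeomorph T T)) :
    TopologicalSpace (GermSpace S) :=
  TopologicalSpace.coinduced (germMap S) inferInstance

/-- The space `T̂₀` of germs at `u₀` of maps in the closure. The target map `T̂₀ → T` is the first
projection. -/
def GermFiber (S : Set (OpenPartialHomeomorph T T)) (u₀ : T) : Type u :=
  Σ y : T, GermHom (closurePseudogroup S) u₀ y

/-- `T̂₀` is a subspace of `T̂`. -/
instance germFiberTopology (S : Set (OpenPartialHomeomorph T T)) (u₀ : T) :
    TopologicalSpace (GermFiber S u₀) :=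
  TopologicalSpace.induced (fun γ => (⟨u₀, γ⟩ : GermSpace S)) (germSpaceTopology S)

end Pseudogroups

/-! ### Leaf topologies -/

/-- The set `Y` with the topology whose basic open sets are the open subsets of the members of
the family `P` of subspaces (the plaques). -/
def Leafwise {Y : Type u} {κ : Type v} (_P : κ → Set Y) : Type u := Y

instance leafTopology {Y : Type u} {κ : Type v} [TopologicalSpace Y] (P : κ → Set Y) :
    TopologicalSpace (Leafwise P) :=
  TopologicalSpace.generateFrom
    {W : Set Y | ∃ (k : κ) (O : Set Y), IsOpen O ∧ W = O ∩ P k}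

/-- The leaf through `y`: its connected component in the leaf topology. -/
def leaf {Y : Type u} {κ : Type v} [TopologicalSpace Y] (P : κ → Set Y) (y : Y) :
    Set (Leafwise P) :=
  connectedComponent (y : Leafwise P)

/-! ### Foliated spaces -/

/-- A foliated atlas of dimension `n` on `X`. -/
structure FoliatedAtlas (X : Type u) [TopologicalSpace X] (n : ℕ) (ι : Type v)
    (T : ι → Type w) [∀ i, TopologicalSpace (T i)] where
  U : ι → Set X
  isOpen_U : ∀ i, IsOpen (U i)
  cover : (⋃ i, U i) = univ
  B : ι → Set (EuclideanSpace ℝ (Fin n))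
  isOpen_B : ∀ i, IsOpen (B i)
  contractible_B : ∀ i, ContractibleSpace (B i)
  ξ : ∀ i, U i ≃ₜ B i × T i
  /-- The intersection of two plaques is open in the first one. -/
  inter_plaques : ∀ (i j : ι) (s : T i) (t : T j), ∃ O : Set X, IsOpen O ∧
    {x | ∃ h : x ∈ U i, (ξ i ⟨x, h⟩).2 = s} ∩ {x | ∃ h : x ∈ U j, (ξ j ⟨x, h⟩).2 = t} =
      O ∩ {x | ∃ h : x ∈ U i, (ξ i ⟨x, h⟩).2 = s}

namespace FoliatedAtlas

variable {X : Type u} [TopologicalSpace X] {n : ℕ} {ι : Type v}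
  {T : ι → Type w} [∀ i, TopologicalSpace (T i)]

/-- The projection `p_i : U_i → T_i`, with values in the disjoint union `T` of all `T_i`. -/
def p (A : FoliatedAtlas X n ι T) (i : ι) (x : A.U i) : Σ i, T i :=
  ⟨i, (A.ξ i x).2⟩

/-- The plaques: the fibers of the projections `p_i`. -/
def plaque (A : FoliatedAtlas X n ι T) (k : Σ i, T i) : Set X :=
  {x | ∃ h : x ∈ A.U k.1, (A.ξ k.1 ⟨x, h⟩).2 = k.2}

/-- All leaves are dense. -/
def IsMinimal (A : FoliatedAtlas X n ι T) : Prop :=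
  ∀ x : X, Dense (X := X) (leaf A.plaque x)

theorem isOpenMap_p (A : FoliatedAtlas X n ι T) (i : ι) : IsOpenMap (A.p i) :=
  isOpenMap_sigmaMk.comp (isOpenMap_snd.comp (A.ξ i).isOpenMap)

theorem continuous_p (A : FoliatedAtlas X n ι T) (i : ι) : Continuous (A.p i) :=
  continuous_sigmaMk.comp (continuous_snd.comp (A.ξ i).continuous)

end FoliatedAtlas

/-- A regular foliated atlas. -/
structure RegularAtlas (X : Type u) [TopologicalSpace X] (n : ℕ) (ι : Type v)
    (T : ι → Type w) [∀ i, TopologicalSpace (T i)] extends FoliatedAtlas X n ι T where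
  /-- There is another foliated atlas, with charts `ξ'_i : U'_i → B'_i × T'_i`, such that the
  closures of `U_i` and `B_i` are contained in `U'_i` and `B'_i`, `T_i` is an open subspace of
  `T'_i` (via `e i`), and `ξ_i` is the restriction of `ξ'_i`. -/
  extension : ∃ (T' : ι → Type w) (_ : ∀ i, TopologicalSpace (T' i))
    (A' : FoliatedAtlas X n ι T') (hU : ∀ i, closure (U i) ⊆ A'.U i) (e : ∀ i, T i → T' i),
    (∀ i, closure (B i) ⊆ A'.B i) ∧ (∀ i, IsOpenEmbedding (e i)) ∧
    ∀ (i : ι) (x : U i),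
      ((A'.ξ i ⟨x, hU i (subset_closure x.2)⟩).1 : EuclideanSpace ℝ (Fin n)) = (ξ i x).1 ∧
      (A'.ξ i ⟨x, hU i (subset_closure x.2)⟩).2 = e i (ξ i x).2
  locallyFinite : LocallyFinite U
  /-- Every plaque of `U_i` meets at most one plaque of `U_j`. -/
  one_plaque : ∀ (i j : ι) (x y : X) (hxi : x ∈ U i) (hyi : y ∈ U i) (hxj : x ∈ U j)
    (hyj : y ∈ U j), (ξ i ⟨x, hxi⟩).2 = (ξ i ⟨y, hyi⟩).2 → (ξ j ⟨x, hxj⟩).2 = (ξ j ⟨y, hyj⟩).2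

namespace RegularAtlas

variable {X : Type u} [TopologicalSpace X] {n : ℕ} {ι : Type v}
  {T : ι → Type w} [∀ i, TopologicalSpace (T i)]

/-- The subset `p_j(U_i ∩ U_j)` of `T_j`. -/
def holDom (A : RegularAtlas X n ι T) (i j : ι) : Set (Σ i, T i) :=
  {t | ∃ (x : X) (_ : x ∈ A.U i) (hj : x ∈ A.U j), A.p j ⟨x, hj⟩ = t}

open Classical in
/-- The map `p_j(x) ↦ p_i(x)`, for `x ∈ U_i ∩ U_j`. -/
noncomputable def holFun (A : RegularAtlas X n ι T) (i j : ι) (t : Σ i, T i) : Σ i, T i :=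
  if h : t ∈ A.holDom i j then A.p i ⟨h.choose, h.choose_spec.choose⟩ else t

theorem p_eq (A : RegularAtlas X n ι T) {i j : ι} {x y : X} (hxi : x ∈ A.U i)
    (hyi : y ∈ A.U i) (hxj : x ∈ A.U j) (hyj : y ∈ A.U j)
    (h : A.p i ⟨x, hxi⟩ = A.p i ⟨y, hyi⟩) : A.p j ⟨x, hxj⟩ = A.p j ⟨y, hyj⟩ := by
  have h1 : (A.ξ i ⟨x, hxi⟩).2 = (A.ξ i ⟨y, hyi⟩).2 := by
    simpa [FoliatedAtlas.p] using h
  have h2 := A.one_plaque i j x y hxi hyi hxj hyj h1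
  simp [FoliatedAtlas.p, h2]

theorem holFun_p (A : RegularAtlas X n ι T) {i j : ι} {x : X} (hi : x ∈ A.U i)
    (hj : x ∈ A.U j) : A.holFun i j (A.p j ⟨x, hj⟩) = A.p i ⟨x, hi⟩ := by
  have h : A.p j ⟨x, hj⟩ ∈ A.holDom i j := ⟨x, hi, hj, rfl⟩
  rw [holFun, dif_pos h]
  exact A.p_eq _ hj _ hi h.choose_spec.choose_spec.choose_spec

theorem isOpen_image (A : RegularAtlas X n ι T) (i j : ι) {W : Set (Σ i, T i)}
    (hW : IsOpen W) :
    IsOpen {t | ∃ (x : X) (hi : x ∈ A.U i) (hj : x ∈ A.U j),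
      A.p i ⟨x, hi⟩ ∈ W ∧ A.p j ⟨x, hj⟩ = t} := by
  have h1 : IsOpen (Subtype.val '' (A.p i ⁻¹' W)) :=
    (A.isOpen_U i).isOpenMap_subtype_val _ (hW.preimage (A.continuous_p i))
  have h2 := A.isOpenMap_p j _ (h1.preimage (continuous_subtype_val (p := (· ∈ A.U j))))
  convert h2 using 1
  ext t
  constructor
  · rintro ⟨x, hi, hj, hx, rfl⟩
    exact ⟨⟨x, hj⟩, ⟨⟨x, hi⟩, hx, rfl⟩, rfl⟩
  · rintro ⟨⟨x, hj⟩, ⟨⟨y, hi⟩, hy, hyx⟩, rfl⟩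
    obtain rfl : y = x := hyx
    exact ⟨y, hi, hj, hy, rfl⟩

theorem isOpen_holDom (A : RegularAtlas X n ι T) (i j : ι) : IsOpen (A.holDom i j) := by
  convert A.isOpen_image i j isOpen_univ using 1
  ext t
  simp [holDom]

theorem continuousOn_holFun (A : RegularAtlas X n ι T) (i j : ι) :
    ContinuousOn (A.holFun i j) (A.holDom i j) := by
  rw [continuousOn_iff']
  intro W hW
  refine ⟨_, A.isOpen_image i j hW, ?_⟩
  ext t
  constructor
  · rintro ⟨ht, x, hi, hj, rfl⟩
    rw [mem_preimage, A.holFun_p hi hj] at ht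
    exact ⟨⟨x, hi, hj, ht, rfl⟩, ⟨x, hi, hj, rfl⟩⟩
  · rintro ⟨⟨x, hi, hj, hx, rfl⟩, h⟩
    refine ⟨?_, h⟩
    rw [mem_preimage, A.holFun_p hi hj]
    exact hx

theorem holFun_mem (A : RegularAtlas X n ι T) (i j : ι) {t : Σ i, T i}
    (ht : t ∈ A.holDom i j) : A.holFun i j t ∈ A.holDom j i := by
  obtain ⟨x, hi, hj, rfl⟩ := ht
  rw [A.holFun_p hi hj]
  exact ⟨x, hj, hi, rfl⟩

theorem holFun_holFun (A : RegularAtlas X n ι T) (i j : ι) {t : Σ i, T i}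
    (ht : t ∈ A.holDom i j) : A.holFun j i (A.holFun i j t) = t := by
  obtain ⟨x, hi, hj, rfl⟩ := ht
  rw [A.holFun_p hi hj, A.holFun_p hj hi]

/-- The elementary holonomy transformation `h_ij : p_j(U_i ∩ U_j) → p_i(U_i ∩ U_j)`, determined
by `h_ij p_j = p_i` on `U_i ∩ U_j`, as a local transformation of the disjoint union of all
`T_i`. -/
noncomputable def h (A : RegularAtlas X n ι T) (i j : ι) :
    OpenPartialHomeomorph (Σ i, T i) (Σ i, T i) where
  toFun := A.holFun i j
  invFun := A.holFun j i
  source := A.holDom i j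
  target := A.holDom j i
  map_source' _ ht := A.holFun_mem i j ht
  map_target' _ ht := A.holFun_mem j i ht
  left_inv' _ ht := A.holFun_holFun i j ht
  right_inv' _ ht := A.holFun_holFun j i ht
  open_source := A.isOpen_holDom i j
  open_target := A.isOpen_holDom j i
  continuousOn_toFun := A.continuousOn_holFun i j
  continuousOn_invFun := A.continuousOn_holFun j i

/-- The holonomy pseudogroup. -/
noncomputable def holonomy (A : RegularAtlas X n ι T) : StructureGroupoid (Σ i, T i) :=
  generatedBy {g | ∃ i j, g = A.h i j}

theorem h_mem (A : RegularAtlas X n ι T) (i j : ι) : A.h i j ∈ A.holonomy :=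
  subset_generatedBy _ ⟨i, j, rfl⟩

/-- `h_I = h_{i_α i_{α-1}} ⋯ h_{i_1 i_0}` for `I = (i_0, …, i_α)`, written as `i_0` followed by the
list `(i_1, …, i_α)`; it is the identity `h_{i_0 i_0}` of `T_{i_0}` if `α = 0`. -/
noncomputable def hSeq (A : RegularAtlas X n ι T) :
    ι → List ι → OpenPartialHomeomorph (Σ i, T i) (Σ i, T i)
  | i, [] => A.h i i
  | i, j :: l => (A.h j i).trans (A.hSeq j l)

theorem hSeq_mem (A : RegularAtlas X n ι T) (i : ι) (l : List ι) :
    A.hSeq i l ∈ A.holonomy := by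
  induction l generalizing i with
  | nil => exact A.h_mem i i
  | cons j l ih => exact A.holonomy.trans (A.h_mem j i) (ih j)

/-- The part of `c` with parameter in `[s, 1]` is covered by the sequence formed by `i` and then
`l`: there is a partition `s = t_0 < t_1 < ⋯ < t_{α+1} = 1` such that `c([t_k, t_{k+1}])` is
contained in the domain of the `k`-th chart of the sequence. -/
def CoversFrom (A : RegularAtlas X n ι T) (c : unitInterval → X) :
    unitInterval → ι → List ι → Prop
  | s, i, [] => s < 1 ∧ ∀ r ∈ Icc s 1, c r ∈ A.U i
  | s, i, j :: l => ∃ t, s < t ∧ (∀ r ∈ Icc s t, c r ∈ A.U i) ∧ A.CoversFrom c t j l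

/-- The holonomy group of the leaf through `x ∈ U_i`, given by germs at `p_i(x)`. -/
abbrev Hol (A : RegularAtlas X n ι T) (i : ι) (x : A.U i) : Type (max v w) :=
  GermHom A.holonomy (A.p i x) (A.p i x)

/-- `X` with the leaf topology. Its paths are the paths in the leaves. -/
abbrev LeafSpace (A : RegularAtlas X n ι T) : Type u := Leafwise A.plaque

/-- Paths, in the leaf through `x`, from `x` to `y`. -/
abbrev LeafPath (A : RegularAtlas X n ι T) (x y : X) : Type u :=
  Path (X := A.LeafSpace) x y

/-- The graph of the holonomy homomorphism: `hol [c] = κ`, for a loop `c` based at `x ∈ U_i`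
in the leaf through `x`. This means that `κ = γ(h_I⁻¹, p_i(x))` for some sequence `I`, beginning
and ending with `i`, that covers `c`. -/
def IsHol (A : RegularAtlas X n ι T) (i : ι) (x : A.U i) (c : A.LeafPath x.1 x.1)
    (κ : A.Hol i x) : Prop :=
  ∃ l : List ι, l.getLastD i = i ∧ A.CoversFrom (fun r => c.toFun r) 0 i l ∧
    ∃ (hs : A.p i x ∈ (A.hSeq i l).symm.source) (he : (A.hSeq i l).symm (A.p i x) = A.p i x),
      κ = germ (A.hSeq i l).symm (A.holonomy.symm (A.hSeq_mem i l)) hs he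

/-- Two paths from `x` in the leaf through `x`, with the same final point, are related if the loop
`c c'⁻¹` is in the kernel of the holonomy homomorphism. -/
inductive SameHol (A : RegularAtlas X n ι T) (i : ι) (x : A.U i) :
    (Σ y : X, A.LeafPath x.1 y) → (Σ y : X, A.LeafPath x.1 y) → Prop
  | mk {y : X} (c c' : A.LeafPath x.1 y) (hc : A.IsHol i x (c.trans c'.symm) 1) :
      SameHol A i x ⟨y, c⟩ ⟨y, c'⟩

/-- The holonomy covering of the leaf through `x`: the covering defined by the kernel of the
holonomy homomorphism, as a set of classes of paths from `x`. -/
def HolCover (A : RegularAtlas X n ι T) (i : ι) (x : A.U i) : Type u :=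
  Quot (A.SameHol i x)

namespace HolCover

variable {A : RegularAtlas X n ι T} {i : ι} {x : A.U i}

/-- The class of a path. -/
def mk {y : X} (c : A.LeafPath x.1 y) : HolCover A i x := Quot.mk _ ⟨y, c⟩

/-- The usual topology of a covering space defined by paths: it is generated by the sets of
classes of the concatenations `c d`, where `c` is a path from `x` to a point of `W`, `d` runs over
the paths in `W` from the final point of `c`, and `W` is an open set of the leaf topology. -/
instance : TopologicalSpace (HolCover A i x) :=
  TopologicalSpace.generateFrom
    {N | ∃ (y : X) (c : A.LeafPath x.1 y) (W : Set A.LeafSpace), IsOpen W ∧ y ∈ W ∧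
      N = {q | ∃ (z : X) (d : A.LeafPath y z), (∀ r, d.toFun r ∈ W) ∧ q = mk (c.trans d)}}

/-- The covering projection: the final point of a path. -/
def proj (q : HolCover A i x) : X :=
  Quot.lift Sigma.fst (by rintro _ _ ⟨c, c', hc⟩; rfl) q

/-- The base point: the class of the constant path. -/
def base (A : RegularAtlas X n ι T) (i : ι) (x : A.U i) : HolCover A i x :=
  mk (Path.refl (X := A.LeafSpace) x.1)

/-- The graph of the canonical right action of the holonomy group by covering transformations:
`q · κ = q'`. It is given by `[c'] · hol [c] = [c⁻¹ c']`. -/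
def IsAct (q : HolCover A i x) (κ : A.Hol i x) (q' : HolCover A i x) : Prop :=
  ∃ (c : A.LeafPath x.1 x.1) (y : X) (c' : A.LeafPath x.1 y),
    A.IsHol i x c κ ∧ q = mk c' ∧ q' = mk (c.symm.trans c')

end HolCover

/-- A generating set `S` of the holonomy pseudogroup, used to define its closure. -/
abbrev Gen (A : RegularAtlas X n ι T) : Type (max v w) := GeneratingSet A.holonomy

variable {A : RegularAtlas X n ι T}

/-- The closure of the holonomy pseudogroup. -/
abbrev Gen.closure (S : A.Gen) : StructureGroupoid (Σ i, T i) := closurePseudogroup S.carrier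

theorem Gen.le_closure (S : A.Gen) : A.holonomy ≤ S.closure := by
  have h := generatedBy_mono (subset_closureSet S.carrier)
  rwa [S.generates] at h

/-- The group `H` of germs at `u₀` of maps in the closure that fix `u₀`. -/
abbrev Gen.H (S : A.Gen) (u₀ : Σ i, T i) : Type (max v w) := GermHom S.closure u₀ u₀

/-- The inclusion of the holonomy group of the leaf through `x ∈ U_i` into the group of germs of
the closure at `p_i(x)`. -/
noncomputable def Gen.inclHol (S : A.Gen) (i : ι) (x : A.U i) : A.Hol i x →* S.H (A.p i x) :=
  GermHom.inclHom S.le_closure (A.p i x)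

/-- The homomorphism `κ ↦ γ⁻¹ κ γ` from the holonomy group of the leaf through `x ∈ U_i` to `H`,
for a germ `γ` from `u₀` to `p_i(x)` in the closure. -/
noncomputable def Gen.conjHol (S : A.Gen) {u₀ : Σ i, T i} (i : ι) (x : A.U i)
    (γ : GermHom S.closure u₀ (A.p i x)) : A.Hol i x →* S.H u₀ :=
  (GermHom.conjHom γ).comp (S.inclHol i x)

/-- The map `ĥ : T̂₀ ⊇ π̂₀⁻¹(dom h) → T̂₀`, `ĥ(γ(g, u₀)) = γ(h g, u₀)`, for `h` in the holonomy
pseudogroup. -/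
noncomputable def Gen.hat (S : A.Gen) {u₀ : Σ i, T i} {g : OpenPartialHomeomorph (Σ i, T i) (Σ i, T i)}
    (hg : g ∈ A.holonomy) (γ : GermFiber S.carrier u₀) (hγ : γ.1 ∈ g.source) :
    GermFiber S.carrier u₀ :=
  ⟨g γ.1, GermHom.comp (germ g (S.le_closure hg) hγ rfl) γ.2⟩

/-- The topological sum of the spaces of all `(x, γ)` in `U_i × T̂₀` with `p_i(x)` equal to the
target of `γ`. -/
abbrev Gen.PreSpace (S : A.Gen) (u₀ : Σ i, T i) : Type (max u v w) :=
  Σ i, {q : A.U i × GermFiber S.carrier u₀ // A.p i q.1 = q.2.1}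

/-- The equivalence relation `(x, γ, i) ∼ (y, δ, j)` if and only if `x = y` and
`γ = ĥ_ij(δ)`. -/
def Gen.Rel (S : A.Gen) (u₀ : Σ i, T i) (a b : S.PreSpace u₀) : Prop :=
  (a.2.1.1 : X) = b.2.1.1 ∧ ∃ hd : b.2.1.2.1 ∈ (A.h a.1 b.1).source,
    a.2.1.2 = S.hat (A.h_mem a.1 b.1) b.2.1.2 hd

/-- The Molino space `X̂₀`. -/
def Gen.Space (S : A.Gen) (u₀ : Σ i, T i) : Type (max u v w) :=
  Quot (S.Rel u₀)

instance (S : A.Gen) (u₀ : Σ i, T i) : TopologicalSpace (S.Space u₀) :=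
  inferInstanceAs (TopologicalSpace (Quot (S.Rel u₀)))

/-- The point `[x, γ, i]` of `X̂₀`. -/
def Gen.point (S : A.Gen) {u₀ : Σ i, T i} (i : ι) (x : A.U i)
    (γ : GermHom S.closure u₀ (A.p i x)) : S.Space u₀ :=
  Quot.mk _ ⟨i, (x, ⟨A.p i x, γ⟩), rfl⟩

/-- The map `π̂₀ : X̂₀ → X`, `[x, γ, i] ↦ x`. -/
def Gen.proj (S : A.Gen) (u₀ : Σ i, T i) (z : S.Space u₀) : X :=
  Quot.lift (fun a : S.PreSpace u₀ => (a.2.1.1 : X)) (fun _ _ h => h.1) z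

/-- The plaques of `X̂₀`: the fibers of the maps `[x, γ, i] ↦ γ` on the open sets `Û_{i,0}` given by
the points of the form `[x, γ, i]`. -/
def Gen.plaque (S : A.Gen) (u₀ : Σ i, T i) (k : ι × GermFiber S.carrier u₀) :
    Set (S.Space u₀) :=
  {z | ∃ (x : A.U k.1) (hx : A.p k.1 x = k.2.1), z = Quot.mk _ ⟨k.1, (x, k.2), hx⟩}

/-- `X̂₀` with the leaf topology. -/
abbrev Gen.LeafSpace (S : A.Gen) (u₀ : Σ i, T i) : Type (max u v w) :=
  Leafwise (S.plaque u₀)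

/-- The leaf of `X̂₀` through a point. -/
def Gen.leaf (S : A.Gen) {u₀ : Σ i, T i} (z : S.Space u₀) : Set (S.Space u₀) :=
  Molino.leaf (S.plaque u₀) z

/-- The right action of `H` on `T̂₀` by the germ product. -/
def Gen.fiberMul (S : A.Gen) {u₀ : Σ i, T i} (γ : GermFiber S.carrier u₀) (σ : S.H u₀) :
    GermFiber S.carrier u₀ :=
  ⟨γ.1, GermHom.comp γ.2 σ⟩

/-- The right action of `H` on `X̂₀`, `[x, γ, i] · σ = [x, γ σ, i]`. -/
def Gen.act (S : A.Gen) {u₀ : Σ i, T i} (z : S.Space u₀) (σ : S.H u₀) : S.Space u₀ :=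
  Quot.map (fun a : S.PreSpace u₀ =>
      (⟨a.1, (a.2.1.1, S.fiberMul a.2.1.2 σ), a.2.2⟩ : S.PreSpace u₀))
    (by
      rintro a b ⟨hab, hd, he⟩
      refine ⟨hab, hd, ?_⟩
      change S.fiberMul a.2.1.2 σ = S.hat (A.h_mem a.1 b.1) (S.fiberMul b.2.1.2 σ) hd
      rw [he]
      simp only [Gen.fiberMul, Gen.hat, GermHom.comp_assoc]
      rfl) z

/-- `X̂₀` as a right `H`-space. -/
instance (S : A.Gen) (u₀ : Σ i, T i) : MulAction (S.H u₀)ᵐᵒᵖ (S.Space u₀) where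
  smul σ z := S.act z σ.unop
  one_smul := by
    rintro ⟨⟨i, ⟨⟨x, y, γ⟩, hx⟩⟩⟩
    change Quot.mk _ (⟨i, (x, ⟨y, GermHom.comp γ (GermHom.one _ _)⟩), hx⟩ : S.PreSpace u₀) = _
    rw [GermHom.comp_one]
  mul_smul := by
    rintro σ τ ⟨⟨i, ⟨⟨x, y, γ⟩, hx⟩⟩⟩
    change Quot.mk _ (⟨i, (x, ⟨y, GermHom.comp γ (GermHom.comp τ.unop σ.unop)⟩), hx⟩ :
        S.PreSpace u₀) =
      Quot.mk _ ⟨i, (x, ⟨y, GermHom.comp (GermHom.comp γ τ.unop) σ.unop⟩), hx⟩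
    rw [GermHom.comp_assoc]

/-- The elements `σ` of `H` with `L̂ · σ = L̂`, where `L̂` is the leaf of `X̂₀` through `z`. -/
def Gen.leafStabilizer (S : A.Gen) {u₀ : Σ i, T i} (z : S.Space u₀) : Set (S.H u₀) :=
  {σ | (fun y : S.Space u₀ => MulOpposite.op σ • y) '' S.leaf z = S.leaf z}

/-- The holonomy covering of the leaf through `x ∈ U_i` is identified with the leaf of `X̂₀` through
`z`, and its inclusion into `X̂₀` is equivariant with respect to `φ : Hol → H`. The identification
`Φ` is a homeomorphism onto the leaf (with the leaf topology) that is compatible with the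
projections to `X` and with the base points, which determines it. -/
def Gen.EquivariantInclusion (S : A.Gen) {u₀ : Σ i, T i} (i : ι) (x : A.U i) (z : S.Space u₀)
    (φ : A.Hol i x →* S.H u₀) : Prop :=
  (∀ q κ, ∃! q', HolCover.IsAct (A := A) (i := i) (x := x) q κ q') ∧
  ∃ Φ : HolCover A i x → S.LeafSpace u₀,
    IsEmbedding Φ ∧ range Φ = S.leaf z ∧ Φ (HolCover.base A i x) = z ∧
    (∀ q, S.proj u₀ (Φ q) = q.proj) ∧
    ∀ q κ q', HolCover.IsAct q κ q' → Φ q' = S.act (Φ q) (φ κ)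

end RegularAtlas

end Molino

/-! With the leaf topologies, `S.proj u₀ : X̂₀ → X` is a covering map (`isCoveringMap_proj`): over a
plaque with transverse coordinate `t` lies one disjoint copy of this plaque for every germ in `T̂₀`
with target `t`. When a path crosses a chain of charts `I`, its lift passes from the plaque of `δ`
to that of `ĥ_I(δ)` (`lift_end`). Since `hol` is defined with inverses, a loop `c` at `x` lifts to a
path from `[x, κγ, i]` to `[x, γ, i]` exactly when `hol [c] = κ` (`liftTo_of_isHol`,
`isHol_of_liftTo`).

The statements about leaves are monodromy theory for this covering. Two paths from `x` have lifts
from `[x, γ, i]` with the same end if and only if they differ by a loop in the kernel of `hol`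
(`sameHol_iff`), so that the end of the lift defines a bijection `holMap` from the holonomy covering
to the leaf; it is an embedding because lifts of small paths stay in one plaque. An element `σ`
preserves the leaf if and only if `[x, γ, i]` and `[x, γσ, i]` are joined by a path in it; the
holonomy `κ` of the projected loop then satisfies `κγ = γσ`. Conversely, `joined_hat` shows, by
induction over the generated pseudogroup, that multiplication by a holonomy germ does not leave the
leaf. The first item is the case `γ = 1`.

The existence of a germ of the closure from `u` to any `v` is an independent analytic fact
(`nonempty_germHom_closure`). By minimality, holonomy maps send `u` arbitrarily near `v`. They have
representatives in `S` on balls of one fixed radius (`exists_controlled_representative`): along a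
path in a leaf a representative is composed with elementary ones, `S² ⊆ S` keeps the composite in
`S`, and equicontinuity keeps the image of the initial ball small, so the radius never has to
shrink. The same holds for the inverses, and quasi-analyticity makes the two families mutually
inverse wherever they can be composed. Their limits along an ultrafilter are continuous and mutually
inverse, and give an element of `S̄` (`exists_mem_closureSet_of_equicontinuous`). -/

namespace Molino

universe u v w

/-! ### Leaf topologies, saturated sets and even coverings -/

section Leafwise

variable {Y : Type u} {κ : Type v} [TopologicalSpace Y] {P : κ → Set Y}

theorem Leafwise.isOpen_inter (k : κ) {O : Set Y} (hO : IsOpen O) :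
    IsOpen (X := Leafwise P) (O ∩ P k : Set Y) :=
  TopologicalSpace.isOpen_generateFrom_of_mem ⟨k, O, hO, rfl⟩

theorem Leafwise.isOpen_plaque (k : κ) : IsOpen (X := Leafwise P) (P k) := by
  exact (univ_inter (P k)) ▸ Leafwise.isOpen_inter (P := P) k isOpen_univ

theorem Leafwise.isOpen_of_isOpen (hc : ∀ y, ∃ k, y ∈ P k) {O : Set Y} (hO : IsOpen O) :
    IsOpen (X := Leafwise P) O := by
  have h : O = ⋃ k, (O ∩ P k) := by
    ext y
    simpa using fun _ => hc y
  rw [h]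
  exact isOpen_iUnion (X := Leafwise P) fun k => Leafwise.isOpen_inter k hO

theorem Leafwise.continuous_toBase (hc : ∀ y, ∃ k, y ∈ P k) :
    Continuous (X := Leafwise P) (Y := Y) (fun y => y) :=
  ⟨fun _ hO => Leafwise.isOpen_of_isOpen hc hO⟩

/-- The traces on plaques of open sets of the leaf topology are relatively open. -/
theorem Leafwise.exists_inter_eq
    (hP : ∀ k l, ∃ O : Set Y, IsOpen O ∧ P k ∩ P l = O ∩ P k)
    {W : Set Y} (hW : IsOpen (X := Leafwise P) W) (k : κ) :
    ∃ O : Set Y, IsOpen O ∧ W ∩ P k = O ∩ P k := by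
  induction hW with
  | basic W h =>
    obtain ⟨l, O, hO, rfl⟩ := h
    obtain ⟨O', hO', h'⟩ := hP k l
    refine ⟨O ∩ O', hO.inter hO', ?_⟩
    rw [inter_assoc, inter_assoc, inter_comm (P l), h']
  | univ => exact ⟨univ, isOpen_univ, rfl⟩
  | inter W W' _ _ h h' =>
    obtain ⟨O, hO, h⟩ := h
    obtain ⟨O', hO', h'⟩ := h'
    refine ⟨O ∩ O', hO.inter hO', ?_⟩
    rw [inter_inter_distrib_right, h, h', ← inter_inter_distrib_right]
  | sUnion C _ h =>
    choose! O hO h using h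
    refine ⟨⋃ W ∈ C, O W, isOpen_biUnion hO, ?_⟩
    rw [sUnion_eq_biUnion, iUnion₂_inter, iUnion₂_inter]
    exact iUnion₂_congr h

/-- On a single plaque the leaf topology and the original topology agree, by
`Leafwise.exists_inter_eq`. This produces every continuous map into a leaf below. -/
theorem Leafwise.continuous_of_mem_plaque
    (hP : ∀ k l, ∃ O : Set Y, IsOpen O ∧ P k ∩ P l = O ∩ P k)
    {Z : Type*} [TopologicalSpace Z] {f : Z → Y} (hf : Continuous f) {k : κ}
    (hk : ∀ z, f z ∈ P k) : Continuous (Y := Leafwise P) f := by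
  refine ⟨fun W hW => ?_⟩
  obtain ⟨O, hO, h⟩ := Leafwise.exists_inter_eq hP hW k
  have : f ⁻¹' W = f ⁻¹' O := by
    ext z
    have h1 : f z ∈ (W : Set Y) ∩ P k ↔ f z ∈ O ∩ P k := Set.ext_iff.1 h (f z)
    exact ⟨fun hz => (h1.1 ⟨hz, hk z⟩).1, fun hz => (h1.2 ⟨hz, hk z⟩).1⟩
  change IsOpen (f ⁻¹' W)
  rw [this]
  exact hO.preimage hf

end Leafwise

/-- A set saturated by the members of an open cover is open and closed. -/
theorem isClopen_of_saturated {Y : Type u} {κ : Type v} [TopologicalSpace Y] {P : κ → Set Y}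
    (hP : ∀ k, IsOpen (P k)) (hc : ∀ y, ∃ k, y ∈ P k) {R : Set Y}
    (h : ∀ k, ∀ y ∈ P k, ∀ z ∈ P k, y ∈ R → z ∈ R) : IsClopen R := by
  refine ⟨isOpen_compl_iff.1 (isOpen_iff_mem_nhds.2 fun y hy => ?_),
    isOpen_iff_mem_nhds.2 fun y hy => ?_⟩ <;> obtain ⟨k, hk⟩ := hc y
  · exact mem_of_superset ((hP k).mem_nhds hk) fun z hz hz' => hy (h k z hz y hk hz')
  · exact mem_of_superset ((hP k).mem_nhds hk) fun z hz => h k y hk z hz hy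

/-- A map is evenly covered at the points of an open set over which its total space is the disjoint
union of the open ranges of a family of continuous sections. -/
theorem isEvenlyCovered_of_sections {E : Type u} {Y : Type v} {I : Type w} [TopologicalSpace E]
    [TopologicalSpace Y] [TopologicalSpace I] [DiscreteTopology I] {f : E → Y}
    (hf : Continuous f) {U : Set Y} (hU : IsOpen U) {y : Y} (hy : y ∈ U) (s : I → U → E)
    (hs : ∀ i, Continuous (s i)) (hfs : ∀ i x, f (s i x) = x)
    (hopen : ∀ i, IsOpen (range (s i))) (hdisj : ∀ i j x, s i x = s j x → i = j)
    (hcov : ∀ e, ∀ h : f e ∈ U, ∃ i, s i ⟨f e, h⟩ = e) : IsEvenlyCovered f y I := by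
  choose idx hidx using hcov
  have hmem : ∀ i (x : U), f (s i x) ∈ U := fun i x => by rw [hfs]; exact x.2
  have hidx' : ∀ i (x : U), idx (s i x) (hmem i x) = i := fun i x => by
    apply hdisj _ _ x
    convert hidx (s i x) (hmem i x) using 2
    exact Subtype.ext (hfs i x).symm
  refine ⟨inferInstance, U, hy, hU, hU.preimage hf,
    { toFun := fun e => (⟨f e, e.2⟩, idx e e.2)
      invFun := fun q => ⟨s q.2 q.1, hmem _ _⟩
      left_inv := fun e => Subtype.ext (hidx e e.2)
      right_inv := fun q => Prod.ext (Subtype.ext (hfs _ _)) (hidx' _ _)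
      continuous_toFun := ?_
      continuous_invFun := ?_ }, fun _ => rfl⟩
  · refine Continuous.prodMk (Continuous.subtype_mk (hf.comp continuous_subtype_val) _) ?_
    refine continuous_discrete_rng.2 fun i => ?_
    convert (hopen i).preimage (continuous_subtype_val (p := (· ∈ f ⁻¹' U))) using 1
    ext ⟨e, he⟩
    constructor
    · rintro h
      exact ⟨⟨f e, he⟩, by
        have := hidx e he
        rwa [show idx e he = i from h] at this⟩
    · rintro ⟨x, hx⟩
      change s i x = e at hx
      subst hx
      exact hidx' i x
  · refine Continuous.subtype_mk ?_ _
    exact (continuous_prod_of_discrete_right (f := fun q : U × I => s q.2 q.1)).2 hs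

/-! ### Plaques of the foliated space -/

namespace RegularAtlas

section Leaves

variable {X : Type u} [TopologicalSpace X] {n : ℕ} {ι : Type v}
  {T : ι → Type w} [∀ i, TopologicalSpace (T i)] (A : RegularAtlas X n ι T)

theorem exists_mem_U (x : X) : ∃ i, x ∈ A.U i := by
  have : x ∈ ⋃ i, A.U i := A.cover ▸ mem_univ x
  exact mem_iUnion.1 this

theorem mem_plaque_p {i : ι} (x : A.U i) : x.1 ∈ A.plaque (A.p i x) := ⟨x.2, rfl⟩

theorem mem_plaque_iff {i : ι} {t : T i} {x : X} :
    x ∈ A.plaque ⟨i, t⟩ ↔ ∃ h : x ∈ A.U i, A.p i ⟨x, h⟩ = ⟨i, t⟩ := by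
  refine exists_congr fun h => ?_
  simp [FoliatedAtlas.p]

theorem mem_plaque_p_iff {i : ι} {y : A.U i} {x : X} :
    x ∈ A.plaque (A.p i y) ↔ ∃ h : x ∈ A.U i, A.p i ⟨x, h⟩ = A.p i y :=
  A.mem_plaque_iff

theorem exists_mem_plaque (x : X) : ∃ k, x ∈ A.plaque k := by
  obtain ⟨i, hi⟩ := A.exists_mem_U x
  exact ⟨_, A.mem_plaque_p ⟨x, hi⟩⟩

theorem plaque_inter_plaque (k l : Σ i, T i) :
    ∃ O : Set X, IsOpen O ∧ A.plaque k ∩ A.plaque l = O ∩ A.plaque k :=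
  A.inter_plaques k.1 l.1 k.2 l.2

theorem isOpen_leaf_plaque (k : Σ i, T i) : IsOpen (X := A.LeafSpace) (A.plaque k) :=
  Leafwise.isOpen_plaque k

theorem isOpen_leaf_of_isOpen {O : Set X} (hO : IsOpen O) : IsOpen (X := A.LeafSpace) O :=
  Leafwise.isOpen_of_isOpen A.exists_mem_plaque hO

/-- The parametrization of a plaque by the Euclidean factor of the chart. -/
def plaqueMap (k : Σ i, T i) (b : A.B k.1) : X := ((A.ξ k.1).symm (b, k.2)).1

theorem plaqueMap_mem (k : Σ i, T i) (b : A.B k.1) : A.plaqueMap k b ∈ A.plaque k :=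
  ⟨((A.ξ k.1).symm (b, k.2)).2, by simp [plaqueMap]⟩

theorem continuous_plaqueMap (k : Σ i, T i) : Continuous (A.plaqueMap k) :=
  continuous_subtype_val.comp ((A.ξ k.1).symm.continuous.comp (by fun_prop))

theorem continuous_plaqueMap_leaf (k : Σ i, T i) :
    Continuous (Y := A.LeafSpace) (A.plaqueMap k) :=
  Leafwise.continuous_of_mem_plaque A.plaque_inter_plaque (A.continuous_plaqueMap k)
    (A.plaqueMap_mem k)

theorem plaqueMap_fst {k : Σ i, T i} {x : X} (hx : x ∈ A.plaque k) :
    A.plaqueMap k (A.ξ k.1 ⟨x, hx.1⟩).1 = x := by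
  obtain ⟨h, h'⟩ := hx
  simp [plaqueMap, ← h']

theorem range_plaqueMap (k : Σ i, T i) : range (A.plaqueMap k) = A.plaque k := by
  refine Subset.antisymm (range_subset_iff.2 (A.plaqueMap_mem k)) fun x hx => ?_
  exact ⟨_, A.plaqueMap_fst hx⟩

theorem isPathConnected_plaque (k : Σ i, T i) :
    IsPathConnected (X := A.LeafSpace) (A.plaque k) := by
  have := A.contractible_B k.1
  exact A.range_plaqueMap k ▸ isPathConnected_range (A.continuous_plaqueMap_leaf k)

theorem plaque_nonempty (k : Σ i, T i) : (A.plaque k).Nonempty :=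
  (A.isPathConnected_plaque k).nonempty

theorem exists_p_eq (t : Σ i, T i) : ∃ (i : ι) (x : A.U i), A.p i x = t := by
  obtain ⟨i, t⟩ := t
  obtain ⟨x, hx⟩ := A.plaque_nonempty ⟨i, t⟩
  obtain ⟨h, h'⟩ := A.mem_plaque_iff.1 hx
  exact ⟨i, _, h'⟩

theorem isOpen_image_plaqueMap (k : Σ i, T i) {N : Set (A.B k.1)} (hN : IsOpen N) :
    IsOpen (X := A.LeafSpace) (A.plaqueMap k '' N : Set X) := by
  have h : A.plaqueMap k '' N =
      (Subtype.val '' ((fun x => (A.ξ k.1 x).1) ⁻¹' N)) ∩ A.plaque k := by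
    ext x
    constructor
    · rintro ⟨b, hb, rfl⟩
      refine ⟨⟨(A.ξ k.1).symm (b, k.2), ?_, rfl⟩, A.plaqueMap_mem k b⟩
      simpa using hb
    · rintro ⟨⟨y, hy, rfl⟩, hx⟩
      exact ⟨_, hy, A.plaqueMap_fst hx⟩
  rw [h]
  refine Leafwise.isOpen_inter k ((A.isOpen_U k.1).isOpenMap_subtype_val _ ?_)
  exact hN.preimage (continuous_fst.comp (A.ξ k.1).continuous)

/-- Local path connectedness of the leaves, inherited from the open set `B_i` of Euclidean space
through `plaqueMap`. -/
theorem exists_joinedIn_nhds {k : Σ i, T i} {W : Set A.LeafSpace} (hW : IsOpen W) {z : X}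
    (hz : z ∈ A.plaque k) (hzW : z ∈ W) :
    ∃ W' : Set A.LeafSpace, IsOpen W' ∧ z ∈ W' ∧ W' ⊆ A.plaque k ∧
      ∀ z' ∈ W', JoinedIn (X := A.LeafSpace) W z z' := by
  have := (A.isOpen_B k.1).locallyPathConnectedSpace
  set b := (A.ξ k.1 ⟨z, hz.1⟩).1
  have hb : A.plaqueMap k b = z := A.plaqueMap_fst hz
  have hN : (A.plaqueMap k) ⁻¹' W ∈ 𝓝 b :=
    (hW.preimage (A.continuous_plaqueMap_leaf k)).mem_nhds (hb.symm ▸ hzW : A.plaqueMap k b ∈ W)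
  obtain ⟨s, ⟨hs, hsc⟩, hsN⟩ := (path_connected_basis b).mem_iff.1 hN
  refine ⟨A.plaqueMap k '' interior s, A.isOpen_image_plaqueMap k isOpen_interior,
    ⟨b, mem_interior_iff_mem_nhds.2 hs, hb⟩, ?_, ?_⟩
  · rintro _ ⟨b', -, rfl⟩
    exact A.plaqueMap_mem k b'
  · rintro _ ⟨b', hb', rfl⟩
    have h1 := hsc.joinedIn b (mem_of_mem_nhds hs) b' (interior_subset hb')
    have h2 := h1.map_continuousOn (Y := A.LeafSpace)
      (A.continuous_plaqueMap_leaf k).continuousOn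
    exact hb ▸ h2.mono (image_subset_iff.2 hsN)

end Leaves

end RegularAtlas

/-! ### Points of the Molino space -/

section

variable {T : Type u} [TopologicalSpace T] {G : StructureGroupoid T} {x y z : T}

/-- The targets `z` and `z'` are equal only by a consequence of `h`, so the comparison takes place
in the sigma type, which is the shape of `GermFiber`. -/
theorem sigma_germ_eq {g g' : OpenPartialHomeomorph T T} {hg : g ∈ G} {hg' : g' ∈ G}
    {hy : y ∈ g.source} {hy' : y ∈ g'.source} {z z' : T} {hz : g y = z} {hz' : g' y = z'}
    (h : (g : T → T) =ᶠ[𝓝 y] g') (a : GermHom G x y) :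
    (⟨z, GermHom.comp (germ g hg hy hz) a⟩ : Σ t, GermHom G x t) =
      ⟨z', GermHom.comp (germ g' hg' hy' hz') a⟩ := by
  obtain rfl : z = z' := by rw [← hz, ← hz', h.eq_of_nhds]
  have : germ (G := G) g hg hy hz = germ g' hg' hy' hz' := Quotient.sound h
  rw [this]

theorem germ_eq_iff {g g' : OpenPartialHomeomorph T T} {hg : g ∈ G} {hg' : g' ∈ G}
    {hy : y ∈ g.source} {hy' : y ∈ g'.source} {hz : g y = z} {hz' : g' y = z} :
    germ (G := G) g hg hy hz = germ g' hg' hy' hz' ↔ (g : T → T) =ᶠ[𝓝 y] g' :=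
  Quotient.eq

theorem exists_germ (a : GermHom G x y) :
    ∃ (g : OpenPartialHomeomorph T T) (hg : g ∈ G) (hx : x ∈ g.source) (hy : g x = y),
      a = germ g hg hx hy := by
  induction a using Quotient.inductionOn with
  | h g => exact ⟨g.1, g.2.1, g.2.2.1, g.2.2.2, rfl⟩

end

namespace RegularAtlas

variable {X : Type u} [TopologicalSpace X] {n : ℕ} {ι : Type v}
  {T : ι → Type w} [∀ i, TopologicalSpace (T i)] {A : RegularAtlas X n ι T}

theorem h_self_eventuallyEq (A : RegularAtlas X n ι T) {i : ι} {t : Σ i, T i}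
    (ht : t ∈ (A.h i i).source) : (A.h i i : (Σ i, T i) → Σ i, T i) =ᶠ[𝓝 t] id := by
  filter_upwards [(A.h i i).open_source.mem_nhds ht]
  rintro _ ⟨x, hi, hj, rfl⟩
  exact A.holFun_p hi hj

/-- Cocycle condition. It holds near `p_i(x)` because `p_i` is open: every nearby point is `p_i(y)`
with `y` in all three charts. -/
theorem h_trans_eventuallyEq (A : RegularAtlas X n ι T) {i j k : ι} {x : X} (hi : x ∈ A.U i)
    (hj : x ∈ A.U j) (hk : x ∈ A.U k) :
    (A.h k j ∘ A.h j i : (Σ i, T i) → Σ i, T i) =ᶠ[𝓝 (A.p i ⟨x, hi⟩)] A.h k i := by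
  have hO : IsOpen (A.p i '' (Subtype.val ⁻¹' (A.U j ∩ A.U k))) :=
    A.isOpenMap_p i _ (((A.isOpen_U j).inter (A.isOpen_U k)).preimage continuous_subtype_val)
  filter_upwards [hO.mem_nhds ⟨⟨x, hi⟩, ⟨hj, hk⟩, rfl⟩]
  rintro _ ⟨⟨y, hyi⟩, ⟨hyj, hyk⟩, rfl⟩
  change A.holFun k j (A.holFun j i _) = A.holFun k i _
  rw [A.holFun_p hyj hyi, A.holFun_p hyk hyj, A.holFun_p hyk hyi]

theorem mem_h_source {i j : ι} {x : X} (hi : x ∈ A.U i) (hj : x ∈ A.U j) :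
    A.p j ⟨x, hj⟩ ∈ (A.h i j).source := ⟨x, hi, hj, rfl⟩

theorem h_apply {i j : ι} {x : X} (hi : x ∈ A.U i) (hj : x ∈ A.U j) :
    A.h i j (A.p j ⟨x, hj⟩) = A.p i ⟨x, hi⟩ := A.holFun_p hi hj

namespace Gen

variable (S : A.Gen) {u₀ : Σ i, T i}

theorem hat_congr {g g' : OpenPartialHomeomorph (Σ i, T i) (Σ i, T i)} {hg : g ∈ A.holonomy}
    {hg' : g' ∈ A.holonomy} {δ : GermFiber S.carrier u₀} {hδ : δ.1 ∈ g.source}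
    {hδ' : δ.1 ∈ g'.source} (h : (g : (Σ i, T i) → Σ i, T i) =ᶠ[𝓝 δ.1] g') :
    S.hat hg δ hδ = S.hat hg' δ hδ' :=
  sigma_germ_eq h δ.2

theorem hat_trans {g g' : OpenPartialHomeomorph (Σ i, T i) (Σ i, T i)} {hg : g ∈ A.holonomy}
    {hg' : g' ∈ A.holonomy} {δ : GermFiber S.carrier u₀} {hδ : δ.1 ∈ g.source}
    {hδ' : (S.hat hg δ hδ).1 ∈ g'.source} :
    S.hat hg' (S.hat hg δ hδ) hδ' =
      S.hat (A.holonomy.trans hg hg') δ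
        (by rw [OpenPartialHomeomorph.trans_source]; exact ⟨hδ, hδ'⟩) := by
  obtain ⟨y, γ⟩ := δ
  simp only [hat]
  rw [← GermHom.comp_assoc]
  rfl

theorem hat_eq_self {g : OpenPartialHomeomorph (Σ i, T i) (Σ i, T i)} {hg : g ∈ A.holonomy}
    {δ : GermFiber S.carrier u₀} {hδ : δ.1 ∈ g.source}
    (h : (g : (Σ i, T i) → Σ i, T i) =ᶠ[𝓝 δ.1] id) : S.hat hg δ hδ = δ := by
  obtain ⟨y, γ⟩ := δ
  refine (sigma_germ_eq (g' := OpenPartialHomeomorph.refl _) (hg' := S.closure.id_mem)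
    (hy' := mem_univ _) (hz' := rfl) h γ).trans ?_
  exact congrArg (Sigma.mk y) (GermHom.one_comp γ)

theorem fst_hat {g : OpenPartialHomeomorph (Σ i, T i) (Σ i, T i)} (hg : g ∈ A.holonomy)
    (δ : GermFiber S.carrier u₀) (hδ : δ.1 ∈ g.source) : (S.hat hg δ hδ).1 = g δ.1 := rfl

/-- The point `[x, δ, i]`, for `δ` in the fiber of germs over `p_i(x)`. -/
def pt (i : ι) (x : A.U i) (δ : GermFiber S.carrier u₀) (h : A.p i x = δ.1) : S.Space u₀ :=
  Quot.mk _ ⟨i, (x, δ), h⟩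

theorem exists_pt (z : S.Space u₀) : ∃ i x δ h, z = S.pt i x δ h := by
  obtain ⟨⟨i, ⟨x, δ⟩, h⟩, rfl⟩ := Quot.exists_rep z
  exact ⟨i, x, δ, h, rfl⟩

/-- Consequence of the cocycle condition. It allows equalities in `Quot (S.Rel u₀)` to be read as
instances of the relation itself, as in `pt_eq_iff`. -/
theorem rel_equivalence : Equivalence (S.Rel u₀) where
  refl := by
    rintro ⟨i, ⟨x, δ⟩, h⟩
    have h' : A.p i x = δ.1 := h
    have hs : δ.1 ∈ (A.h i i).source := h' ▸ mem_h_source x.2 x.2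
    exact ⟨rfl, hs, (S.hat_eq_self (A.h_self_eventuallyEq hs)).symm⟩
  symm := by
    rintro ⟨i, ⟨⟨x, hx⟩, δ⟩, h⟩ ⟨j, ⟨⟨y, hy⟩, ε⟩, h'⟩ ⟨hxy, hd, he⟩
    obtain rfl : x = y := hxy
    have h'' : A.p j ⟨x, hy⟩ = ε.1 := h'
    have he : δ = S.hat (A.h_mem i j) ε hd := he
    -- The domain condition in the conclusion depends on the germ, so the germ is generalized before
    -- its equation is substituted.
    have key : ∀ δ', δ' = S.hat (A.h_mem i j) ε hd →
        ∃ hs : δ'.1 ∈ (A.h j i).source, ε = S.hat (A.h_mem j i) δ' hs := by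
      rintro _ rfl
      refine ⟨(A.h i j).map_source hd, ?_⟩
      refine ((S.hat_trans).trans (S.hat_eq_self ?_)).symm
      rw [← h'']
      refine (A.h_trans_eventuallyEq hy hx hy).trans (A.h_self_eventuallyEq ?_)
      exact mem_h_source hy hy
    exact ⟨rfl, key δ he⟩
  trans := by
    rintro ⟨i, ⟨⟨x, hx⟩, δ⟩, h⟩ ⟨j, ⟨⟨y, hy⟩, ε⟩, h'⟩ ⟨k, ⟨⟨z, hz⟩, ζ⟩, h''⟩ ⟨hxy, hd, he⟩
      ⟨hyz, hd', he'⟩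
    obtain rfl : x = y := hxy
    obtain rfl : x = z := hyz
    have h3 : A.p k ⟨x, hz⟩ = ζ.1 := h''
    have he : δ = S.hat (A.h_mem i j) ε hd := he
    have he' : ε = S.hat (A.h_mem j k) ζ hd' := he'
    have hs : ζ.1 ∈ (A.h i k).source := h3 ▸ mem_h_source hx hz
    have key : ∀ ε' (hd : ε'.1 ∈ (A.h i j).source), ε' = S.hat (A.h_mem j k) ζ hd' →
        S.hat (A.h_mem i j) ε' hd = S.hat (A.h_mem i k) ζ hs := by
      rintro _ hd rfl
      rw [hat_trans]
      refine S.hat_congr ?_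
      rw [← h3]
      exact A.h_trans_eventuallyEq hz hy hx
    exact ⟨rfl, hs, he.trans (key ε hd he')⟩

theorem pt_eq_iff {i j : ι} {x : A.U i} {y : A.U j} {δ ε : GermFiber S.carrier u₀}
    {h : A.p i x = δ.1} {h' : A.p j y = ε.1} :
    S.pt i x δ h = S.pt j y ε h' ↔
      (x : X) = y ∧ ∃ hd : ε.1 ∈ (A.h i j).source, δ = S.hat (A.h_mem i j) ε hd :=
  ⟨fun e => S.rel_equivalence.eqvGen_iff.1 (Quot.eqvGen_exact e), fun e => Quot.sound e⟩

theorem pt_injective {i : ι} {x : A.U i} {δ ε : GermFiber S.carrier u₀}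
    {h : A.p i x = δ.1} {h' : A.p i x = ε.1} (e : S.pt i x δ h = S.pt i x ε h') : δ = ε := by
  obtain ⟨-, hd, he⟩ := S.pt_eq_iff.1 e
  rw [he, S.hat_eq_self (A.h_self_eventuallyEq hd)]

/-- Change of chart. -/
theorem pt_eq_pt_hat {i j : ι} {x : X} (hi : x ∈ A.U i) (hj : x ∈ A.U j)
    {δ : GermFiber S.carrier u₀} (h : A.p i ⟨x, hi⟩ = δ.1) :
    S.pt i ⟨x, hi⟩ δ h = S.pt j ⟨x, hj⟩
      (S.hat (A.h_mem j i) δ (h ▸ mem_h_source hj hi))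
      (by rw [fst_hat, ← h, h_apply hj hi]) :=
  (S.pt_eq_iff (x := ⟨x, hj⟩) (y := ⟨x, hi⟩) (h' := h).2 ⟨rfl, (h ▸ mem_h_source hj hi : δ.1 ∈ (A.h j i).source), rfl⟩).symm

theorem exists_pt_of_mem {i : ι} (z : S.Space u₀) (hz : S.proj u₀ z ∈ A.U i) :
    ∃ δ, ∃ h : A.p i ⟨S.proj u₀ z, hz⟩ = δ.1, z = S.pt i ⟨S.proj u₀ z, hz⟩ δ h := by
  obtain ⟨j, x, δ, h, rfl⟩ := S.exists_pt z
  exact ⟨_, _, S.pt_eq_pt_hat x.2 hz h⟩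

theorem pt_mem_plaque {i : ι} {x : A.U i} {δ ε : GermFiber S.carrier u₀} {h : A.p i x = δ.1} :
    S.pt i x δ h ∈ S.plaque u₀ (i, ε) ↔ δ = ε := by
  constructor
  · rintro ⟨y, h', e⟩
    have e : S.pt i x δ h = S.pt i y ε h' := e
    have hxy : x = y := Subtype.ext (congrArg (S.proj u₀) e)
    subst hxy
    exact S.pt_injective e
  · rintro rfl
    exact ⟨x, h, rfl⟩

theorem pt_mem_plaque_iff {i j : ι} {x : X} (hi : x ∈ A.U i) (hj : x ∈ A.U j)
    {δ ε : GermFiber S.carrier u₀} (h : A.p i ⟨x, hi⟩ = δ.1) :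
    S.pt i ⟨x, hi⟩ δ h ∈ S.plaque u₀ (j, ε) ↔
      S.hat (A.h_mem j i) δ (h ▸ mem_h_source hj hi) = ε := by
  rw [S.pt_eq_pt_hat hi hj h]
  exact S.pt_mem_plaque

theorem exists_mem_plaque (z : S.Space u₀) : ∃ k, z ∈ S.plaque u₀ k := by
  obtain ⟨i, x, δ, h, rfl⟩ := S.exists_pt z
  exact ⟨(i, δ), x, h, rfl⟩

theorem continuous_proj : Continuous (S.proj u₀) := by
  refine continuous_coinduced_dom.2 ?_
  refine continuous_sigma fun i => ?_
  exact continuous_subtype_val.comp (continuous_fst.comp continuous_subtype_val)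

/-- The section `x ↦ [x, δ, i]` over the chart plaque defined by `δ`. -/
theorem continuous_pt {Z : Type*} [TopologicalSpace Z] {i : ι} {f : Z → A.U i}
    (hf : Continuous f) {δ : GermFiber S.carrier u₀} (h : ∀ z, A.p i (f z) = δ.1) :
    Continuous fun z => S.pt i (f z) δ (h z) := by
  refine continuous_coinduced_rng.comp (continuous_sigmaMk.comp ?_)
  exact Continuous.subtype_mk (hf.prodMk continuous_const) _

/-- The germs of a point in two charts determine each other. Hence, if the plaques of `δ` and `ε`
share one point, they share all points of the first plaque that lie over `U_j`. -/
theorem plaque_inter_plaque (k l : ι × GermFiber S.carrier u₀) :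
    ∃ O : Set (S.Space u₀), IsOpen O ∧ S.plaque u₀ k ∩ S.plaque u₀ l = O ∩ S.plaque u₀ k := by
  obtain ⟨i, δ⟩ := k
  obtain ⟨j, ε⟩ := l
  by_cases hne : (S.plaque u₀ (i, δ) ∩ S.plaque u₀ (j, ε)).Nonempty
  · refine ⟨S.proj u₀ ⁻¹' A.U j, (A.isOpen_U j).preimage S.continuous_proj, ?_⟩
    obtain ⟨z, ⟨x, h, rfl⟩, ⟨x', h', e⟩⟩ := hne
    have e : S.pt i x δ h = S.pt j x' ε h' := e
    obtain ⟨-, hd, he⟩ := S.pt_eq_iff.1 e.symm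
    ext z
    constructor
    · rintro ⟨h1, ⟨y, hy, rfl⟩⟩
      exact ⟨y.2, h1⟩
    · rintro ⟨hz, ⟨y, hy, rfl⟩⟩
      refine ⟨⟨y, hy, rfl⟩, ⟨y, hz⟩, ?_, ?_⟩
      · rw [he, fst_hat, ← hy]
        exact (h_apply hz y.2).symm
      · refine (S.pt_eq_pt_hat y.2 hz hy).trans ?_
        rw [Gen.pt]
        congr 2
        simp only [Subtype.mk.injEq, Prod.mk.injEq, true_and]
        exact he.symm
  · exact ⟨∅, isOpen_empty, by rw [not_nonempty_iff_eq_empty.1 hne, empty_inter]⟩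

theorem isOpen_leaf_plaque (k : ι × GermFiber S.carrier u₀) :
    IsOpen (X := S.LeafSpace u₀) (S.plaque u₀ k) :=
  Leafwise.isOpen_plaque k

/-- The part of `X̂₀` over a plaque of `X` is the union of the plaques of all germs with that
target. -/
theorem continuous_proj_leaf :
    Continuous (X := S.LeafSpace u₀) (Y := A.LeafSpace) (S.proj u₀) := by
  refine continuous_generateFrom_iff.2 ?_
  rintro _ ⟨⟨i, t⟩, O, hO, rfl⟩
  have h1 : IsOpen (X := S.LeafSpace u₀) (S.proj u₀ ⁻¹' O : Set (S.Space u₀)) :=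
    Leafwise.isOpen_of_isOpen S.exists_mem_plaque (hO.preimage S.continuous_proj)
  have h2 : IsOpen (X := S.LeafSpace u₀) (S.proj u₀ ⁻¹' A.plaque ⟨i, t⟩ : Set (S.Space u₀)) := by
    have : S.proj u₀ ⁻¹' A.plaque ⟨i, t⟩ =
        ⋃ δ : {δ : GermFiber S.carrier u₀ // δ.1 = ⟨i, t⟩}, S.plaque u₀ (i, δ.1) := by
      ext z
      rw [mem_iUnion]
      constructor
      · intro hz
        obtain ⟨hz, hz'⟩ := A.mem_plaque_iff.1 hz
        obtain ⟨δ, h, e⟩ := S.exists_pt_of_mem z hz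
        exact ⟨⟨δ, h ▸ hz'⟩, _, h, e⟩
      · rintro ⟨⟨δ, hδ⟩, x, hx, rfl⟩
        exact A.mem_plaque_iff.2 ⟨x.2, hx.trans hδ⟩
    rw [this]
    exact isOpen_iUnion (X := S.LeafSpace u₀) fun δ => S.isOpen_leaf_plaque _
  exact h1.inter h2

/-- The local section of the projection over a plaque. -/
def sect (i : ι) (δ : GermFiber S.carrier u₀)
    (x : {x : A.LeafSpace // ∃ h : x ∈ A.U i, A.p i ⟨x, h⟩ = δ.1}) : S.LeafSpace u₀ :=
  S.pt i ⟨x.1, x.2.1⟩ δ x.2.2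

theorem continuous_sect (i : ι) (δ : GermFiber S.carrier u₀) : Continuous (S.sect i δ) := by
  refine Leafwise.continuous_of_mem_plaque S.plaque_inter_plaque (k := (i, δ)) ?_
    fun x => ⟨⟨x.1, x.2.1⟩, x.2.2, rfl⟩
  refine S.continuous_pt (Continuous.subtype_mk ?_ _) _
  exact (Leafwise.continuous_toBase A.exists_mem_plaque).comp continuous_subtype_val

theorem range_sect (i : ι) (δ : GermFiber S.carrier u₀) :
    range (S.sect i δ) = S.plaque u₀ (i, δ) := by
  ext z
  constructor
  · rintro ⟨x, rfl⟩
    exact ⟨⟨x.1, x.2.1⟩, x.2.2, rfl⟩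
  · rintro ⟨x, h, rfl⟩
    exact ⟨⟨x.1, x.2, h⟩, rfl⟩

/-- The plaque of `y` is evenly covered: the sheets are indexed by the germs `δ` over `p_i(y)` with
the discrete topology, and the sections are `x ↦ [x, δ, i]`. They are disjoint by `pt_injective`. -/
theorem isCoveringMap_proj :
    IsCoveringMap (E := S.LeafSpace u₀) (X := A.LeafSpace) (S.proj u₀) := by
  intro y
  obtain ⟨i, hi⟩ := A.exists_mem_U y
  let I := {δ : GermFiber S.carrier u₀ // A.p i ⟨y, hi⟩ = δ.1}
  let _ : TopologicalSpace I := ⊥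
  have : DiscreteTopology I := ⟨rfl⟩
  refine IsEvenlyCovered.to_isEvenlyCovered_preimage (I := I) ?_
  let U : Set A.LeafSpace := {x | ∃ h : x ∈ A.U i, A.p i ⟨x, h⟩ = A.p i ⟨y, hi⟩}
  have hU : U = A.plaque (A.p i ⟨y, hi⟩) := ext fun x => A.mem_plaque_p_iff.symm
  refine isEvenlyCovered_of_sections S.continuous_proj_leaf (U := U)
    (hU ▸ A.isOpen_leaf_plaque _) ⟨hi, rfl⟩
    (fun δ x => S.sect i δ.1 ⟨x.1, x.2.choose, x.2.choose_spec.trans δ.2⟩) (fun δ => ?_)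
    (fun δ x => rfl) (fun δ => ?_) (fun δ ε x e => ?_) (fun e h => ?_)
  · exact (S.continuous_sect i δ.1).comp (Continuous.subtype_mk continuous_subtype_val _)
  · have : range (fun x : U => S.sect i δ.1 ⟨x.1, x.2.choose, x.2.choose_spec.trans δ.2⟩) =
        S.plaque u₀ (i, δ.1) := by
      rw [← S.range_sect]
      refine Subset.antisymm ?_ ?_
      · rintro _ ⟨x, rfl⟩
        exact ⟨_, rfl⟩
      · rintro _ ⟨x, rfl⟩
        exact ⟨⟨x.1, x.2.1, x.2.2.trans δ.2.symm⟩, rfl⟩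
    rw [this]
    exact S.isOpen_leaf_plaque _
  · exact Subtype.ext (S.pt_injective e)
  · obtain ⟨h1, h2⟩ := h
    obtain ⟨δ, hδ, he⟩ := S.exists_pt_of_mem e h1
    exact ⟨⟨δ, h2.symm.trans hδ⟩, he.symm⟩

end Gen

end RegularAtlas

/-! ### Induction on germs of a generated pseudogroup -/

section Pseudogroups

variable {T : Type u} [TopologicalSpace T]

theorem closedUnderRestriction_generatedBy (S : Set (OpenPartialHomeomorph T T)) :
    ClosedUnderRestriction (generatedBy S) := by
  refine ⟨fun {e} he s hs => mem_iInter₂.2 fun G hG => ?_⟩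
  have := hG.1
  exact closedUnderRestriction' (mem_iInter₂.1 he G hG) hs

/-- To prove a property of the germs of a generated pseudogroup, it is enough to check it for the
generators and to show that it is stable under the germ operations. -/
theorem generatedBy_induction {S : Set (OpenPartialHomeomorph T T)}
    {P : OpenPartialHomeomorph T T → T → Prop}
    (basic : ∀ g ∈ S, ∀ x ∈ g.source, P g x)
    (refl : ∀ x, P (OpenPartialHomeomorph.refl T) x)
    (symm : ∀ g ∈ generatedBy S, ∀ x ∈ g.source, P g x → P g.symm (g x))
    (trans : ∀ g ∈ generatedBy S, ∀ h ∈ generatedBy S, ∀ x ∈ g.source, g x ∈ h.source →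
      P g x → P h (g x) → P (g.trans h) x)
    (congr : ∀ g ∈ generatedBy S, ∀ h ∈ generatedBy S, ∀ x ∈ g.source, x ∈ h.source →
      (g : T → T) =ᶠ[𝓝 x] h → P g x → P h x)
    {g : OpenPartialHomeomorph T T} (hg : g ∈ generatedBy S) {x : T} (hx : x ∈ g.source) :
    P g x := by
  have := closedUnderRestriction_generatedBy S
  -- The elements with the property at all points of their domains form a pseudogroup. The
  -- hypothesis `congr` gives the locality axioms and closure under restriction.
  let G : StructureGroupoid T :=
    { members := {g | g ∈ generatedBy S ∧ ∀ x ∈ g.source, P g x}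
      trans' := fun g h hg hh => by
        refine ⟨(generatedBy S).trans hg.1 hh.1, fun x hx => ?_⟩
        rw [OpenPartialHomeomorph.trans_source] at hx
        exact trans g hg.1 h hh.1 x hx.1 hx.2 (hg.2 x hx.1) (hh.2 _ hx.2)
      symm' := fun g hg => by
        refine ⟨(generatedBy S).symm hg.1, fun y hy => ?_⟩
        have h := symm g hg.1 (g.symm y) (g.map_target hy) (hg.2 _ (g.map_target hy))
        rwa [g.right_inv hy] at h
      id_mem' := ⟨(generatedBy S).id_mem, fun x _ => refl x⟩
      locality' := fun e he => by
        have he' : e ∈ generatedBy S := (generatedBy S).locality fun x hx => by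
          obtain ⟨s, hs, hxs, h⟩ := he x hx
          exact ⟨s, hs, hxs, h.1⟩
        refine ⟨he', fun x hx => ?_⟩
        obtain ⟨s, hs, hxs, h⟩ := he x hx
        have hx' : x ∈ (e.restr s).source := by
          rw [e.restr_source' s hs]; exact ⟨hx, hxs⟩
        exact congr (e.restr s) h.1 e he' x hx' hx EventuallyEq.rfl (h.2 x hx')
      mem_of_eqOnSource' := fun e e' he hee' => by
        have he' := (generatedBy S).mem_of_eqOnSource he.1 hee'
        refine ⟨he', fun x hx => ?_⟩
        have hx' : x ∈ e.source := hee'.1 ▸ hx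
        exact congr e he.1 e' he' x hx' hx
          (hee'.2.eventuallyEq_of_mem (e'.open_source.mem_nhds hx)).symm (he.2 x hx') }
  have hG : ClosedUnderRestriction G := ⟨fun {e} he s hs => by
    have h1 := closedUnderRestriction' he.1 hs
    refine ⟨h1, fun x hx => ?_⟩
    have hx' : x ∈ e.source := by
      rw [e.restr_source' s hs] at hx; exact hx.1
    exact congr e he.1 _ h1 x hx' hx EventuallyEq.rfl (he.2 x hx')⟩
  exact (mem_iInter₂.1 hg G ⟨hG, fun g hg => ⟨subset_generatedBy S hg, basic g hg⟩⟩).2 x hx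

end Pseudogroups

/-! ### Chains of charts and lifts of paths -/

namespace RegularAtlas

variable {X : Type u} [TopologicalSpace X] {n : ℕ} {ι : Type v}
  {T : ι → Type w} [∀ i, TopologicalSpace (T i)] {A : RegularAtlas X n ι T}

section Chains

/-- A sequence covering a path from `s` on covers it from slightly later parameters on. -/
theorem CoversFrom.exists_gt {c : unitInterval → X} {s : unitInterval} {i : ι} {l : List ι}
    (h : A.CoversFrom c s i l) : ∃ t, s < t ∧ ∀ r, s ≤ r → r < t → A.CoversFrom c r i l := by
  cases l with
  | nil => exact ⟨1, h.1, fun r hr hr' => ⟨hr', fun q hq => h.2 q ⟨hr.trans hq.1, hq.2⟩⟩⟩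
  | cons j l =>
    obtain ⟨t, hst, h1, h2⟩ := h
    exact ⟨t, hst, fun r hr hr' => ⟨t, hr', fun q hq => h1 q ⟨hr.trans hq.1, hq.2⟩, h2⟩⟩

theorem CoversFrom.mem_start {c : unitInterval → X} {s : unitInterval} {i : ι} {l : List ι}
    (h : A.CoversFrom c s i l) : c s ∈ A.U i := by
  cases l with
  | nil => exact h.2 s ⟨le_rfl, h.1.le⟩
  | cons j l =>
    obtain ⟨t, hst, h1, -⟩ := h
    exact h1 s ⟨le_rfl, hst.le⟩

/-- Every path is covered by a sequence of charts with prescribed first and last members. -/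
theorem exists_coversFrom {c : unitInterval → X} (hc : ∀ i, IsOpen (c ⁻¹' A.U i)) {i j : ι}
    (hi : c 0 ∈ A.U i) (hj : c 1 ∈ A.U j) :
    ∃ l : List ι, l.getLastD i = j ∧ A.CoversFrom c 0 i l := by
  have hcov : (univ : Set unitInterval) ⊆ ⋃ i, c ⁻¹' A.U i := fun r _ => by
    obtain ⟨k, hk⟩ := A.exists_mem_U (c r)
    exact mem_iUnion.2 ⟨k, hk⟩
  obtain ⟨t, ht0, htm, ⟨m, hm⟩, hsub⟩ :=
    exists_monotone_Icc_subset_open_cover_unitInterval hc hcov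
  -- Backward induction from the end of the partition. Its points may coincide, whereas `CoversFrom`
  -- requires strict inequalities; so either the parameter is already `1`, or there is a strict
  -- chain from it on, with an uncontrolled first chart.
  have key : ∀ q ≤ m, t (m - q) = 1 ∨ ∃ k l, List.getLastD l k = j ∧
      A.CoversFrom c (t (m - q)) k l := by
    intro q
    induction q with
    | zero => exact fun _ => Or.inl (hm _ le_rfl)
    | succ q ih =>
      intro hq
      have hs : m - q = (m - (q + 1)) + 1 := by omega
      set a := m - (q + 1)
      obtain ⟨k, hk⟩ := hsub a
      have ih := ih (by omega)
      rw [hs] at ih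
      rcases (htm (Nat.le_succ a)).eq_or_lt with h | h
      · rw [h]
        exact ih
      · right
        rcases ih with h1 | ⟨k', l, hl, hcl⟩
        · rw [Nat.succ_eq_add_one, h1] at h
          rw [h1] at hk
          -- The last interval is cut at `e` near `1`, so that the final piece lies in `U_j` and the
          -- chain ends with the prescribed `j`.
          obtain ⟨b, hb, hb'⟩ := exists_Ioc_subset_of_mem_nhds ((hc j).mem_nhds hj) ⟨_, h⟩
          obtain ⟨e, he, he1⟩ := exists_between (max_lt hb h)
          refine ⟨k, [j], rfl, e, (le_max_right _ _).trans_lt he, fun r hr => ?_, he1,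
            fun r hr => ?_⟩
          · exact hk ⟨hr.1, hr.2.trans he1.le⟩
          · exact hb' ⟨(le_max_left _ _).trans_lt (he.trans_le hr.1), hr.2⟩
        · exact ⟨k, k' :: l, by rw [List.getLastD_cons, hl], _, h, fun r hr => hk hr, hcl⟩
  have h0 := key m le_rfl
  rw [Nat.sub_self, ht0] at h0
  rcases h0 with h0 | ⟨k, l, hl, hcl⟩
  · exact absurd h0 zero_ne_one
  -- Symmetrically, a short piece `[0, f]` inside `U_i` is put in front to make `i` the first chart.
  obtain ⟨b, hb, hb'⟩ := hcl.exists_gt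
  obtain ⟨e, he, he'⟩ := exists_Ico_subset_of_mem_nhds ((hc i).mem_nhds hi) ⟨_, hb⟩
  obtain ⟨f, hf, hf'⟩ := exists_between (lt_min hb he)
  refine ⟨k :: l, by rw [List.getLastD_cons, hl], f, hf, fun r hr => he' ⟨hr.1, ?_⟩,
    hb' f hf.le (hf'.trans_le (min_le_left _ _))⟩
  exact hr.2.trans_lt (hf'.trans_le (min_le_right _ _))

end Chains

namespace Gen

variable (S : A.Gen) {u₀ : Σ i, T i}

theorem proj_act (z : S.Space u₀) (σ : S.H u₀) : S.proj u₀ (S.act z σ) = S.proj u₀ z := by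
  obtain ⟨i, x, δ, h, rfl⟩ := S.exists_pt z
  rfl

theorem act_one (z : S.Space u₀) : S.act z 1 = z := one_smul (S.H u₀)ᵐᵒᵖ z

theorem act_mul (z : S.Space u₀) (σ τ : S.H u₀) : S.act z (σ * τ) = S.act (S.act z σ) τ :=
  mul_smul (MulOpposite.op τ) (MulOpposite.op σ) z

/-- On the plaque of `δ`, the action of `σ` is the projection to `X` followed by the section defined
by `δσ`. -/
theorem continuous_act (σ : S.H u₀) :
    Continuous (X := S.LeafSpace u₀) (Y := S.LeafSpace u₀) (fun z => S.act z σ) := by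
  refine continuous_iff_continuousAt.2 fun z => ?_
  obtain ⟨i, x, δ, h, hz⟩ := S.exists_pt z
  have hzP : z ∈ S.plaque u₀ (i, δ) := ⟨x, h, hz⟩
  refine ContinuousOn.continuousAt (α := S.LeafSpace u₀) (β := S.LeafSpace u₀) (s := S.plaque u₀ (i, δ)) ?_
    ((S.isOpen_leaf_plaque (i, δ)).mem_nhds hzP)
  refine continuousOn_iff_continuous_domRestrict.2 ?_
  have hmem : ∀ y : {y : S.LeafSpace u₀ // y ∈ S.plaque u₀ (i, δ)},
      ∃ h : S.proj u₀ y.1 ∈ A.U i, A.p i ⟨S.proj u₀ y.1, h⟩ = δ.1 := by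
    rintro ⟨_, x, h, rfl⟩
    exact ⟨x.2, h⟩
  have h1 : Continuous fun y : {y : S.LeafSpace u₀ // y ∈ S.plaque u₀ (i, δ)} =>
      S.sect i (S.fiberMul δ σ) ⟨S.proj u₀ y.1, hmem y⟩ :=
    (S.continuous_sect i (S.fiberMul δ σ)).comp
      (Continuous.subtype_mk (S.continuous_proj_leaf.comp continuous_subtype_val) _)
  refine h1.congr ?_
  rintro ⟨_, x, h, rfl⟩
  rfl

/-- A path in a plaque of `X` lifts to the plaques above it. -/
theorem exists_lift_pt {i : ι} {δ : GermFiber S.carrier u₀} (c : C(unitInterval, A.LeafSpace))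
    (hc : ∀ r, ∃ h : c r ∈ A.U i, A.p i ⟨c r, h⟩ = δ.1) :
    ∃ Γ : C(unitInterval, S.LeafSpace u₀),
      ∀ r, Γ r = S.pt i ⟨c r, (hc r).1⟩ δ (hc r).2 :=
  ⟨⟨fun r => S.sect i δ ⟨c r, hc r⟩,
    (S.continuous_sect i δ).comp (Continuous.subtype_mk c.continuous _)⟩, fun _ => rfl⟩

theorem joined_pt {i : ι} {x y : A.U i} {δ : GermFiber S.carrier u₀} (hx : A.p i x = δ.1)
    (hy : A.p i y = δ.1) :
    Joined (X := S.LeafSpace u₀) (S.pt i x δ hx) (S.pt i y δ hy) := by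
  obtain ⟨c, hc⟩ := (A.isPathConnected_plaque (A.p i x)).joinedIn x.1 (A.mem_plaque_p x) y.1
    (A.mem_plaque_p_iff.2 ⟨y.2, hy.trans hx.symm⟩)
  obtain ⟨Γ, hΓ⟩ := S.exists_lift_pt (δ := δ) c.toContinuousMap fun r => by
    obtain ⟨h, h'⟩ := A.mem_plaque_p_iff.1 (hc r)
    exact ⟨h, h'.trans hx⟩
  refine ⟨⟨Γ, (hΓ 0).trans ?_, (hΓ 1).trans ?_⟩⟩
  · congr 1
    exact Subtype.ext c.source'
  · congr 1
    exact Subtype.ext c.target'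

/-- The points of the Molino space given by a germ and by its product with a germ of the holonomy
pseudogroup are in the same leaf. -/
theorem joined_hat {g : OpenPartialHomeomorph (Σ i, T i) (Σ i, T i)} (hg : g ∈ A.holonomy)
    {δ : GermFiber S.carrier u₀} (hδ : δ.1 ∈ g.source) {i j : ι} {x : A.U i} {y : A.U j}
    (hx : A.p i x = δ.1) (hy : A.p j y = (S.hat hg δ hδ).1) :
    Joined (X := S.LeafSpace u₀) (S.pt i x δ hx) (S.pt j y (S.hat hg δ hδ) hy) := by
  -- The property ranges over all points of `X` above the source and target of the germ. The
  -- equation `δ.1 = t` replaces a dependence of `δ` on `t`.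
  let P : OpenPartialHomeomorph (Σ i, T i) (Σ i, T i) → (Σ i, T i) → Prop := fun g t =>
    ∀ (hg : g ∈ A.holonomy) (δ : GermFiber S.carrier u₀) (hδ : δ.1 ∈ g.source) (i j : ι)
      (x : A.U i) (y : A.U j) (hx : A.p i x = δ.1) (hy : A.p j y = (S.hat hg δ hδ).1),
      δ.1 = t → Joined (X := S.LeafSpace u₀) (S.pt i x δ hx) (S.pt j y (S.hat hg δ hδ) hy)
  have idx : ∀ {i j : ι} {x : A.U i} {y : A.U j}, A.p i x = A.p j y → i = j :=
    fun e => congrArg Sigma.fst e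
  have same : ∀ {i j : ι} {x : A.U i} {y : A.U j} {δ ε : GermFiber S.carrier u₀}
      (hx : A.p i x = δ.1) (hy : A.p j y = ε.1), δ = ε →
      Joined (X := S.LeafSpace u₀) (S.pt i x δ hx) (S.pt j y ε hy) := by
    rintro i j x y δ _ hx hy rfl
    obtain rfl := idx (hx.trans hy.symm)
    exact S.joined_pt hx hy
  refine generatedBy_induction (P := P) ?_ ?_ ?_ ?_ ?_ hg hδ hg δ hδ i j x y hx hy rfl
  · rintro _ ⟨a, b, rfl⟩ _ ⟨z, ha, hb, rfl⟩ hg δ hδ i j x y hx hy hδz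
    refine (same hx hδz.symm rfl).trans ?_
    have h1 := S.pt_eq_pt_hat hb ha hδz.symm
    rw [h1]
    exact same _ hy rfl
  · intro t hg δ hδ i j x y hx hy _
    exact same hx hy (S.hat_eq_self EventuallyEq.rfl).symm
  · intro g hg t ht ih hg' δ hδ i j x y hx hy hδt
    have hs : (S.hat hg' δ hδ).1 ∈ g.source := g.map_target hδ
    -- The induction hypothesis for `g` is applied to the image of `δ` under `g⁻¹`, and the
    -- resulting path is reversed.
    have h1 : S.hat hg (S.hat hg' δ hδ) hs = δ := by
      refine S.hat_trans.trans (S.hat_eq_self ?_)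
      exact g.eventually_right_inverse hδ
    have h2 := ih hg (S.hat hg' δ hδ) hs j i y x hy (by rw [h1, hx]) (by
      rw [fst_hat, hδt, g.left_inv ht])
    exact (h2.trans (same _ hx h1)).symm
  · intro g hg h hh t ht hgt ihg ihh hgh δ hδ i j x y hx hy hδt
    -- An intermediate point over `g(t)` exists because every plaque is non-empty.
    obtain ⟨k, z, hz⟩ := A.exists_p_eq (g t)
    subst hδt
    have h1 := ihg hg δ ht i k x z hx hz rfl
    have h2 : S.hat hh (S.hat hg δ ht) hgt = S.hat hgh δ hδ := S.hat_trans
    have h3 := ihh hh (S.hat hg δ ht) hgt k j z y hz (by rw [h2, hy]) rfl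
    exact h1.trans (h3.trans (same _ hy h2))
  · intro g hg h hh t ht ht' hgh ih hh' δ hδ i j x y hx hy hδt
    subst hδt
    have h1 : S.hat hg δ ht = S.hat hh' δ hδ := S.hat_congr hgh
    have h2 := ih hg δ ht i j x y hx (by rw [h1, hy]) rfl
    exact h2.trans (same _ hy h1)

section PathLifting

variable {Γ : unitInterval → S.LeafSpace u₀} {c : unitInterval → X}

/-- Over `U_i` the plaques indexed by germs are disjoint and open in the leaf topology, so a
connected piece of the lift cannot change plaque. -/
theorem mem_plaque_of_continuous (hΓ : Continuous Γ) (hc : ∀ r, S.proj u₀ (Γ r) = c r)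
    {s t : unitInterval} (hst : s ≤ t) {i : ι} (hi : ∀ r ∈ Icc s t, c r ∈ A.U i)
    {δ : GermFiber S.carrier u₀} (hs : Γ s ∈ S.plaque u₀ (i, δ)) :
    Γ t ∈ S.plaque u₀ (i, δ) := by
  let V : Set (S.LeafSpace u₀) := ⋃ ε : {ε : GermFiber S.carrier u₀ // ε ≠ δ},
    S.plaque u₀ (i, ε.1)
  have hV : IsOpen V := isOpen_iUnion fun ε => S.isOpen_leaf_plaque _
  have hpre : IsPreconnected (Γ '' Icc s t) := isPreconnected_Icc.image _ hΓ.continuousOn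
  refine hpre.subset_left_of_subset_union (S.isOpen_leaf_plaque (i, δ)) hV ?_ ?_
    ⟨Γ s, mem_image_of_mem Γ (left_mem_Icc.2 hst), hs⟩ (mem_image_of_mem Γ (right_mem_Icc.2 hst))
  · refine Set.disjoint_left.2 ?_
    rintro _ ⟨x, h, rfl⟩ hV
    obtain ⟨ε, hε⟩ := mem_iUnion.1 hV
    exact ε.2 (S.pt_mem_plaque.1 hε).symm
  · rintro _ ⟨r, hr, rfl⟩
    obtain ⟨ε, h, e⟩ := S.exists_pt_of_mem (i := i) (Γ r) (by rw [hc]; exact hi r hr)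
    by_cases hε : ε = δ
    · subst hε
      exact Or.inl ⟨_, h, e⟩
    · exact Or.inr (mem_iUnion.2 ⟨⟨ε, hε⟩, _, h, e⟩)

/-- The lift of a path covered by a sequence of charts is transported by the holonomy of the
sequence. -/
theorem lift_end (hΓ : Continuous Γ) (hc : ∀ r, S.proj u₀ (Γ r) = c r) (l : List ι)
    {s : unitInterval} {i : ι} (hl : A.CoversFrom c s i l) {δ : GermFiber S.carrier u₀}
    (hs : Γ s ∈ S.plaque u₀ (i, δ)) :
    ∃ hd : δ.1 ∈ (A.hSeq i l).source,
      Γ 1 ∈ S.plaque u₀ (l.getLastD i, S.hat (A.hSeq_mem i l) δ hd) := by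
  induction l generalizing s i δ with
  | nil =>
    have hd : δ.1 ∈ (A.h i i).source := by
      obtain ⟨x, h, -⟩ := hs
      exact h ▸ mem_h_source x.2 x.2
    refine ⟨hd, ?_⟩
    -- The empty list stands for `h_ii`, which is the identity only on its domain.
    have h1 : S.hat (A.hSeq_mem i []) δ hd = δ := S.hat_eq_self (A.h_self_eventuallyEq hd)
    rw [h1]
    exact S.mem_plaque_of_continuous hΓ hc hl.1.le hl.2 hs
  | cons j l ih =>
    obtain ⟨t, hst, h1, h2⟩ := hl
    obtain ⟨x, hx, hΓt⟩ := S.mem_plaque_of_continuous hΓ hc hst.le h1 hs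
    have hΓt : Γ t = S.pt i x δ hx := hΓt
    have hxt : (x : X) = c t := by rw [← hc, hΓt]; rfl
    have hxj : (x : X) ∈ A.U j := hxt ▸ h2.mem_start
    have hd : δ.1 ∈ (A.h j i).source := by
      rw [← show A.p i x = δ.1 from hx]
      exact mem_h_source hxj x.2
    obtain ⟨hd', h3⟩ := ih h2 (δ := S.hat (A.h_mem j i) δ hd) (by
      rw [hΓt, S.pt_eq_pt_hat x.2 hxj hx]
      exact S.pt_mem_plaque.2 rfl)
    refine ⟨by rw [hSeq, OpenPartialHomeomorph.trans_source]; exact ⟨hd, hd'⟩, ?_⟩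
    rw [List.getLastD_cons]
    convert h3 using 3
    exact S.hat_trans.symm

end PathLifting

end Gen

end RegularAtlas

namespace GermHom

variable {T : Type u} [TopologicalSpace T] {G G' : StructureGroupoid T} {x y z : T}

/-- Equality of germs only involves the maps near the point, not the ambient pseudogroup. -/
theorem incl_injective (hG : G ≤ G') :
    Function.Injective (incl hG : GermHom G x y → GermHom G' x y) := by
  intro a b h
  obtain ⟨a, rfl⟩ := Quotient.exists_rep a
  obtain ⟨b, rfl⟩ := Quotient.exists_rep b
  exact Quotient.sound (Quotient.exact (s := germSetoid G' x y) h :)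

theorem comp_right_cancel {b b' : GermHom G y z} {a : GermHom G x y}
    (h : comp b a = comp b' a) : b = b' := by
  have := congrArg (fun c => comp c (inv a)) h
  simpa only [comp_assoc, comp_inv, comp_one] using this

theorem comp_conjHom (a : GermHom G x y) (κ : GermHom G y y) :
    comp a (conjHom a κ) = comp κ a := by
  change comp a (comp (inv a) (comp κ a)) = _
  rw [← comp_assoc, comp_inv, one_comp]

theorem conjHom_injective (a : GermHom G x y) : Function.Injective (conjHom a) := by
  intro κ κ' h
  have := congrArg (comp a) h
  rw [comp_conjHom, comp_conjHom] at this
  exact comp_right_cancel this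

end GermHom

/-! ### Leaf stabilizers and monodromy of the covering -/

namespace RegularAtlas

variable {X : Type u} [TopologicalSpace X] {n : ℕ} {ι : Type v}
  {T : ι → Type w} [∀ i, TopologicalSpace (T i)] {A : RegularAtlas X n ι T}

namespace Gen

variable (S : A.Gen) {u₀ : Σ i, T i}

theorem inclHol_injective (i : ι) (x : A.U i) : Function.Injective (S.inclHol i x) :=
  GermHom.incl_injective S.le_closure

theorem conjHol_injective (i : ι) (x : A.U i) (γ : GermHom S.closure u₀ (A.p i x)) :
    Function.Injective (S.conjHol i x γ) :=
  (GermHom.conjHom_injective γ).comp (S.inclHol_injective i x)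

/-- Plaques are open and path connected, so path components are saturated by plaques, hence open and
closed. Leaves, defined as connected components, may thus be studied by paths. -/
theorem mem_leaf_iff {z w : S.Space u₀} :
    w ∈ S.leaf z ↔ Joined (X := S.LeafSpace u₀) z w := by
  constructor
  · intro hw
    have hcl : IsClopen (X := S.LeafSpace u₀) (pathComponent (X := S.LeafSpace u₀) z) := by
      refine isClopen_of_saturated S.isOpen_leaf_plaque S.exists_mem_plaque ?_
      rintro ⟨i, δ⟩ _ ⟨x, hx, rfl⟩ _ ⟨y, hy, rfl⟩ h
      exact Joined.trans (X := S.LeafSpace u₀) h (S.joined_pt hx hy)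
    exact hcl.connectedComponent_subset (mem_pathComponent_self (X := S.LeafSpace u₀) z) hw
  · exact fun h => pathComponent_subset_component (X := S.LeafSpace u₀) z h

/-- Both `σ` and `σ⁻¹` act continuously on the leaf topology, so `σ` permutes the leaves, and the
image of one point decides whether a leaf is preserved. -/
theorem mem_leafStabilizer_iff {z : S.Space u₀} {σ : S.H u₀} :
    σ ∈ S.leafStabilizer z ↔ Joined (X := S.LeafSpace u₀) z (S.act z σ) := by
  have hz : z ∈ S.leaf z := S.mem_leaf_iff.2 (Joined.refl (X := S.LeafSpace u₀) z)
  constructor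
  · intro h
    have h : (fun y => S.act y σ) '' S.leaf z = S.leaf z := h
    exact S.mem_leaf_iff.1 (h ▸ mem_image_of_mem (fun y => S.act y σ) hz)
  · intro h
    change (fun y => S.act y σ) '' S.leaf z = S.leaf z
    ext w
    constructor
    · rintro ⟨w, hw, rfl⟩
      exact S.mem_leaf_iff.2 (h.trans ((S.mem_leaf_iff.1 hw).map (S.continuous_act σ)))
    · intro hw
      refine ⟨S.act w σ⁻¹, S.mem_leaf_iff.2 ?_, ?_⟩
      · have h1 := h.map (S.continuous_act σ⁻¹)
        rw [← act_mul, mul_inv_cancel, act_one] at h1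
        exact h1.symm.trans ((S.mem_leaf_iff.1 hw).map (S.continuous_act σ⁻¹))
      · change S.act (S.act w σ⁻¹) σ = w
        rw [← act_mul, inv_mul_cancel, act_one]

/-- The lift to the Molino space of the path `c` in a leaf, starting at `z`, ends at `w`. -/
def LiftTo (z w : S.Space u₀) {x y : X} (c : A.LeafPath x y) : Prop :=
  ∃ Γ : C(unitInterval, S.LeafSpace u₀), Γ 0 = z ∧ Γ 1 = w ∧
    ∀ r, S.proj u₀ (Γ r) = c.toFun r

variable {S} in
theorem LiftTo.proj_end {z w : S.Space u₀} {x y : X} {c : A.LeafPath x y}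
    (h : S.LiftTo z w c) : S.proj u₀ w = y := by
  obtain ⟨Γ, h0, h1, hc⟩ := h
  rw [← h1, hc]
  exact c.target'

theorem exists_liftTo {z : S.Space u₀} {x y : X} (hz : S.proj u₀ z = x) (c : A.LeafPath x y) :
    ∃ w, S.LiftTo z w c := by
  obtain ⟨Γ, h1, h2⟩ := S.isCoveringMap_proj.exists_path_lifts c.toContinuousMap z
    (c.source'.trans hz.symm)
  exact ⟨Γ 1, Γ, h2, rfl, fun r => congrFun h1 r⟩

variable {S} in
theorem LiftTo.unique {z w w' : S.Space u₀} {x y : X} {c : A.LeafPath x y}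
    (h : S.LiftTo z w c) (h' : S.LiftTo z w' c) : w = w' := by
  obtain ⟨Γ, h0, h1, hc⟩ := h
  obtain ⟨Γ', h0', h1', hc'⟩ := h'
  have := S.isCoveringMap_proj.eq_of_comp_eq Γ.continuous Γ'.continuous
    (funext fun r => (hc r).trans (hc' r).symm) 0 (h0.trans h0'.symm)
  rw [← h1, ← h1', this]

variable {S} in
theorem LiftTo.trans {z w v : S.Space u₀} {x y x' : X} {c : A.LeafPath x y}
    {d : A.LeafPath y x'} (h : S.LiftTo z w c) (h' : S.LiftTo w v d) :
    S.LiftTo z v (c.trans d) := by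
  obtain ⟨Γ, h0, h1, hc⟩ := h
  obtain ⟨Γ', h0', h1', hd⟩ := h'
  let P : Path (X := S.LeafSpace u₀) z w := ⟨Γ, h0, h1⟩
  let P' : Path (X := S.LeafSpace u₀) w v := ⟨Γ', h0', h1'⟩
  refine ⟨(P.trans P').toContinuousMap, (P.trans P').source', (P.trans P').target', fun r => ?_⟩
  change S.proj u₀ ((P.trans P').toFun r) = (c.trans d).toFun r
  have h1 := Path.trans_apply P P' r
  have h2 := Path.trans_apply (X := A.LeafSpace) c d r
  split_ifs at h1 h2
  · exact (congrArg (S.proj u₀) h1).trans ((hc _).trans h2.symm)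
  · exact (congrArg (S.proj u₀) h1).trans ((hd _).trans h2.symm)

variable {S} in
theorem LiftTo.symm {z w : S.Space u₀} {x y : X} {c : A.LeafPath x y}
    (h : S.LiftTo z w c) : S.LiftTo w z c.symm := by
  obtain ⟨Γ, h0, h1, hc⟩ := h
  let P : Path (X := S.LeafSpace u₀) z w := ⟨Γ, h0, h1⟩
  exact ⟨P.symm.toContinuousMap, P.symm.source', P.symm.target', fun r => hc (unitInterval.symm r)⟩

variable {S} in
theorem LiftTo.act {z w : S.Space u₀} {x y : X} {c : A.LeafPath x y}
    (h : S.LiftTo z w c) (σ : S.H u₀) : S.LiftTo (S.act z σ) (S.act w σ) c := by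
  obtain ⟨Γ, h0, h1, hc⟩ := h
  exact ⟨⟨_, (S.continuous_act σ).comp Γ.continuous⟩, congrArg (fun z => S.act z σ) h0,
    congrArg (fun z => S.act z σ) h1, fun r => (S.proj_act _ σ).trans (hc r)⟩

variable {S} in
theorem LiftTo.joined {z w : S.Space u₀} {x y : X} {c : A.LeafPath x y}
    (h : S.LiftTo z w c) : Joined (X := S.LeafSpace u₀) z w := by
  obtain ⟨Γ, h0, h1, -⟩ := h
  exact ⟨⟨Γ, h0, h1⟩⟩

theorem exists_liftTo_of_joined {z w : S.Space u₀} {x y : X}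
    (h : Joined (X := S.LeafSpace u₀) z w) (hz : S.proj u₀ z = x) (hw : S.proj u₀ w = y) :
    ∃ c : A.LeafPath x y, S.LiftTo z w c := by
  obtain ⟨Γ⟩ := h
  subst hz hw
  exact ⟨Γ.map S.continuous_proj_leaf, Γ.toContinuousMap, Γ.source', Γ.target', fun r => rfl⟩

theorem liftTo_pt {i : ι} {δ : GermFiber S.carrier u₀} {x y : A.U i}
    {c : A.LeafPath x.1 y.1} (hc : ∀ r, c.toFun r ∈ A.plaque δ.1)
    (hx : A.p i x = δ.1) (hy : A.p i y = δ.1) :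
    S.LiftTo (S.pt i x δ hx) (S.pt i y δ hy) c := by
  obtain ⟨Γ, hΓ⟩ := S.exists_lift_pt (δ := δ) c.toContinuousMap fun r => by
    obtain ⟨h, h'⟩ := A.mem_plaque_p_iff.1 (hx ▸ hc r)
    exact ⟨h, h'.trans hx⟩
  refine ⟨Γ, (hΓ 0).trans ?_, (hΓ 1).trans ?_, fun r => by rw [hΓ r]; rfl⟩
  · congr 1
    exact Subtype.ext c.source'
  · congr 1
    exact Subtype.ext c.target'

section Holonomy

variable {i : ι} {x : A.U i}

theorem point_mem_plaque {γ : GermHom S.closure u₀ (A.p i x)} {δ : GermFiber S.carrier u₀} :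
    S.point i x γ ∈ S.plaque u₀ (i, δ) ↔ ⟨A.p i x, γ⟩ = δ := S.pt_mem_plaque

theorem eq_point_of_mem_plaque {γ : GermHom S.closure u₀ (A.p i x)} {w : S.Space u₀}
    (h : w ∈ S.plaque u₀ (i, ⟨A.p i x, γ⟩)) (hw : S.proj u₀ w = x) : w = S.point i x γ := by
  obtain ⟨y, hy, rfl⟩ := h
  change S.pt i y _ hy = S.pt i x _ rfl
  congr 1
  exact Subtype.ext hw

theorem hat_mk {g : OpenPartialHomeomorph (Σ i, T i) (Σ i, T i)} (hg : g ∈ A.holonomy)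
    {y z : Σ i, T i} (hy : y ∈ g.source) (hz : g y = z) (γ : GermHom S.closure u₀ y) :
    S.hat hg ⟨y, γ⟩ hy =
      ⟨z, GermHom.comp (GermHom.incl S.le_closure (germ g hg hy hz)) γ⟩ := by
  subst hz
  rfl

/-- The lift that starts at `[x, κγ, i]` is transported by `h_I`, while `κ` is the germ of `h_I⁻¹`;
the two cancel. -/
theorem liftTo_of_isHol {c : A.LeafPath x.1 x.1} {κ : A.Hol i x} (h : A.IsHol i x c κ)
    (γ : GermHom S.closure u₀ (A.p i x)) :
    S.LiftTo (S.point i x (GermHom.comp (S.inclHol i x κ) γ)) (S.point i x γ) c := by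
  obtain ⟨l, hl, hcl, hs, he, rfl⟩ := h
  set κ := germ (A.hSeq i l).symm (A.holonomy.symm (A.hSeq_mem i l)) hs he
  obtain ⟨w, hw⟩ := S.exists_liftTo (u₀ := u₀)
    (z := S.point i x (GermHom.comp (S.inclHol i x κ) γ)) rfl c
  have hpw := hw.proj_end
  have hw' := hw
  obtain ⟨Γ, h0, h1, hc⟩ := hw
  obtain ⟨hd, h2⟩ := S.lift_end Γ.continuous hc l hcl
    (δ := ⟨A.p i x, GermHom.comp (S.inclHol i x κ) γ⟩) (by rw [h0]; exact S.point_mem_plaque.2 rfl)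
  -- Here `κγ` is the image of `γ` under `h_I⁻¹`, so applying `h_I` gives `γ` again.
  have h3 : S.hat (A.hSeq_mem i l) ⟨A.p i x, GermHom.comp (S.inclHol i x κ) γ⟩ hd =
      ⟨A.p i x, γ⟩ := by
    have h4 : S.hat (A.holonomy.symm (A.hSeq_mem i l)) ⟨A.p i x, γ⟩ hs =
        ⟨A.p i x, GermHom.comp (S.inclHol i x κ) γ⟩ :=
      S.hat_mk _ hs he γ
    have key : ∀ δ, S.hat (A.holonomy.symm (A.hSeq_mem i l)) ⟨A.p i x, γ⟩ hs = δ →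
        ∀ hd, S.hat (A.hSeq_mem i l) δ hd = ⟨A.p i x, γ⟩ := by
      rintro _ rfl hd
      exact S.hat_trans.trans (S.hat_eq_self ((A.hSeq i l).eventually_right_inverse hs))
    exact key _ h4 hd
  rw [h1, hl, h3] at h2
  rwa [S.eq_point_of_mem_plaque h2 hpw] at hw'

/-- Take a chain covering `c` that begins and ends with `i`. The lift forces `γ` to be the image of
`γ'` under `h_I`, so `h_I` fixes `p_i(x)` and the germ `κ` of `h_I⁻¹` satisfies `κγ = γ'`. -/
theorem exists_isHol_of_liftTo {c : A.LeafPath x.1 x.1}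
    {γ γ' : GermHom S.closure u₀ (A.p i x)}
    (h : S.LiftTo (S.point i x γ') (S.point i x γ) c) :
    ∃ κ : A.Hol i x, A.IsHol i x c κ ∧ GermHom.comp (S.inclHol i x κ) γ = γ' := by
  obtain ⟨l, hl, hcl⟩ := exists_coversFrom (A := A) (c := fun r => c.toFun r) (i := i) (j := i)
    (fun j => (A.isOpen_leaf_of_isOpen (A.isOpen_U j)).preimage c.continuous)
    (by have : c.toFun 0 = x.1 := c.source'
        change c.toFun 0 ∈ A.U i
        rw [this]; exact x.2)
    (by have : c.toFun 1 = x.1 := c.target'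
        change c.toFun 1 ∈ A.U i
        rw [this]; exact x.2)
  obtain ⟨Γ, h0, h1, hc⟩ := h
  obtain ⟨hd, h2⟩ := S.lift_end Γ.continuous hc l hcl
    (δ := ⟨A.p i x, γ'⟩) (by rw [h0]; exact S.point_mem_plaque.2 rfl)
  rw [h1, hl] at h2
  have h3 := S.point_mem_plaque.1 h2
  have h4 : A.p i x = A.hSeq i l (A.p i x) := congrArg Sigma.fst h3
  have hs : A.p i x ∈ (A.hSeq i l).symm.source := by
    have := (A.hSeq i l).map_source hd
    rwa [← show A.p i x = A.hSeq i l (A.p i x) from h4] at this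
  have he : (A.hSeq i l).symm (A.p i x) = A.p i x := by
    conv_lhs => rw [h4]
    exact (A.hSeq i l).left_inv hd
  refine ⟨_, ⟨l, hl, hcl, hs, he, rfl⟩, ?_⟩
  have h5 : S.hat (A.holonomy.symm (A.hSeq_mem i l)) ⟨A.p i x, γ⟩ hs = ⟨A.p i x, γ'⟩ := by
    have key : ∀ δ, δ = S.hat (A.hSeq_mem i l) ⟨A.p i x, γ'⟩ hd →
        ∀ hs, S.hat (A.holonomy.symm (A.hSeq_mem i l)) δ hs = ⟨A.p i x, γ'⟩ := by
      rintro _ rfl hs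
      exact S.hat_trans.trans (S.hat_eq_self ((A.hSeq i l).eventually_left_inverse hd))
    exact key _ h3 hs
  have h6 := (S.hat_mk _ hs he γ).symm.trans h5
  exact eq_of_heq (Sigma.mk.inj h6).2

/-- The germ found from the lift must be `κ`, by right cancellation of `γ` and injectivity of the
inclusion of germ groups. -/
theorem isHol_of_liftTo {c : A.LeafPath x.1 x.1} {γ : GermHom S.closure u₀ (A.p i x)}
    {κ : A.Hol i x}
    (h : S.LiftTo (S.point i x (GermHom.comp (S.inclHol i x κ) γ)) (S.point i x γ) c) :
    A.IsHol i x c κ := by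
  obtain ⟨κ', h1, h2⟩ := S.exists_isHol_of_liftTo h
  rwa [← S.inclHol_injective i x (GermHom.comp_right_cancel h2)]

theorem joined_point_comp (γ : GermHom S.closure u₀ (A.p i x)) (κ : A.Hol i x) :
    Joined (X := S.LeafSpace u₀) (S.point i x γ)
      (S.point i x (GermHom.comp (S.inclHol i x κ) γ)) := by
  obtain ⟨g, hg, hx, hy, rfl⟩ := exists_germ κ
  have h := S.joined_hat hg (δ := ⟨A.p i x, γ⟩) hx (x := x) (y := x) rfl hy.symm
  have h1 : S.hat hg ⟨A.p i x, γ⟩ hx =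
      ⟨A.p i x, GermHom.comp (S.inclHol i x (germ g hg hx hy)) γ⟩ :=
    S.hat_mk hg hx hy γ
  have key : ∀ δ, ∀ h' : A.p i x = δ.1,
      δ = ⟨A.p i x, GermHom.comp (S.inclHol i x (germ g hg hx hy)) γ⟩ →
      Joined (X := S.LeafSpace u₀) (S.point i x γ) (S.pt i x δ h') →
      Joined (X := S.LeafSpace u₀) (S.point i x γ)
        (S.point i x (GermHom.comp (S.inclHol i x (germ g hg hx hy)) γ)) := by
    rintro _ _ rfl h
    exact h
  exact key _ _ h1 h

/-- Every holonomy germ is the holonomy of a loop. -/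
theorem exists_isHol (γ : GermHom S.closure u₀ (A.p i x)) (κ : A.Hol i x) :
    ∃ c, A.IsHol i x c κ := by
  -- The joining path is reversed because a loop with holonomy `κ` lifts from `κγ` to `γ`.
  obtain ⟨c, hc⟩ := S.exists_liftTo_of_joined (S.joined_point_comp γ κ).symm rfl rfl
  exact ⟨c, S.isHol_of_liftTo hc⟩

theorem act_point_conjHol (γ : GermHom S.closure u₀ (A.p i x)) (κ : A.Hol i x) :
    S.act (S.point i x γ) (S.conjHol i x γ κ) =
      S.point i x (GermHom.comp (S.inclHol i x κ) γ) := by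
  rw [← GermHom.comp_conjHom]
  rfl

/-- The two inclusions are `joined_point_comp` and the monodromy of a path from `[x, γσ, i]` to `[x,
γ, i]`: it yields `κγ = γσ`, that is, `σ = γ⁻¹κγ`. -/
theorem range_conjHol (γ : GermHom S.closure u₀ (A.p i x)) :
    range (S.conjHol i x γ) = S.leafStabilizer (S.point i x γ) := by
  ext σ
  rw [mem_leafStabilizer_iff]
  constructor
  · rintro ⟨κ, rfl⟩
    rw [act_point_conjHol]
    exact S.joined_point_comp γ κ
  · intro h
    have h1 : S.act (S.point i x γ) σ = S.point i x (GermHom.comp γ σ) := rfl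
    rw [h1] at h
    obtain ⟨c, hc⟩ := S.exists_liftTo_of_joined h.symm rfl rfl
    obtain ⟨κ, -, hκ⟩ := S.exists_isHol_of_liftTo hc
    refine ⟨κ, ?_⟩
    change GermHom.comp (GermHom.inv γ) (GermHom.comp (S.inclHol i x κ) γ) = σ
    rw [hκ, ← GermHom.comp_assoc, GermHom.inv_comp, GermHom.one_comp]

variable (γ : GermHom S.closure u₀ (A.p i x))

-- A loop has trivial holonomy exactly when its lift closes. One direction makes `holMap` well
-- defined, the other makes it injective.
include γ in
theorem sameHol_iff {y : X} {c c' : A.LeafPath x.1 y} {w w' : S.Space u₀}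
    (h : S.LiftTo (S.point i x γ) w c) (h' : S.LiftTo (S.point i x γ) w' c') :
    A.IsHol i x (c.trans c'.symm) 1 ↔ w = w' := by
  have h1 : GermHom.comp (S.inclHol i x 1) γ = γ := by
    rw [map_one]
    exact GermHom.one_comp γ
  constructor
  · intro hc
    have h2 := S.liftTo_of_isHol hc γ
    rw [h1] at h2
    -- Lifting `c'⁻¹` from `w` must lead back to `[x, γ, i]`. Reversed, this is the lift of `c'`
    -- from `[x, γ, i]`, and it ends at `w`.
    obtain ⟨v, hv⟩ := S.exists_liftTo h.proj_end c'.symm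
    have h3 := hv
    rw [(h.trans hv).unique h2] at h3
    have h4 : S.LiftTo (S.point i x γ) w c' :=
      (congrArg (S.LiftTo _ _) (Path.symm_symm (X := A.LeafSpace) c')).mp h3.symm
    exact h4.unique h'
  · rintro rfl
    refine S.isHol_of_liftTo (γ := γ) ?_
    rw [h1]
    exact h.trans h'.symm

/-- The map that sends the class of a path to the final point of its lift. -/
noncomputable def holMap : HolCover A i x → S.LeafSpace u₀ :=
  Quot.lift (fun c => (S.exists_liftTo (z := S.point i x γ) rfl c.2).choose) (by
    rintro _ _ ⟨c, c', hc⟩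
    exact (S.sameHol_iff γ (S.exists_liftTo (z := S.point i x γ) rfl c).choose_spec
      (S.exists_liftTo (z := S.point i x γ) rfl c').choose_spec).1 hc)

theorem liftTo_holMap {y : X} (c : A.LeafPath x.1 y) :
    S.LiftTo (S.point i x γ) (S.holMap γ (HolCover.mk c)) c :=
  (S.exists_liftTo (z := S.point i x γ) rfl c).choose_spec

theorem holMap_mk {y : X} {c : A.LeafPath x.1 y} {w : S.Space u₀}
    (h : S.LiftTo (S.point i x γ) w c) : S.holMap γ (HolCover.mk c) = w :=
  (S.liftTo_holMap γ c).unique h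

theorem exists_mk (q : HolCover A i x) :
    ∃ (y : X) (c : A.LeafPath x.1 y), q = HolCover.mk c := by
  obtain ⟨⟨y, c⟩, rfl⟩ := Quot.exists_rep q
  exact ⟨y, c, rfl⟩

theorem proj_holMap (q : HolCover A i x) : S.proj u₀ (S.holMap γ q) = q.proj := by
  obtain ⟨y, c, rfl⟩ := exists_mk q
  exact (S.liftTo_holMap γ c).proj_end

theorem holMap_injective : Function.Injective (S.holMap γ) := by
  intro q q' h
  obtain ⟨y, c, rfl⟩ := exists_mk q
  obtain ⟨y', c', rfl⟩ := exists_mk q'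
  obtain rfl : y = y' := by
    rw [← (S.liftTo_holMap γ c).proj_end, h, (S.liftTo_holMap γ c').proj_end]
  exact Quot.sound ⟨c, c', (S.sameHol_iff γ (S.liftTo_holMap γ c) (S.liftTo_holMap γ c')).2 h⟩

theorem range_holMap : range (S.holMap γ) = S.leaf (S.point i x γ) := by
  ext w
  refine Iff.trans ?_ (S.mem_leaf_iff (z := S.point i x γ)).symm
  constructor
  · rintro ⟨q, rfl⟩
    obtain ⟨y, c, rfl⟩ := exists_mk q
    exact (S.liftTo_holMap γ c).joined
  · intro h
    obtain ⟨c, hc⟩ := S.exists_liftTo_of_joined h rfl rfl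
    exact ⟨_, S.holMap_mk γ hc⟩

theorem holMap_base : S.holMap γ (HolCover.base A i x) = S.point i x γ :=
  S.holMap_mk γ ⟨ContinuousMap.const _ _, rfl, rfl, fun _ => rfl⟩

/-- The lift of `c⁻¹` goes from `[x, γ, i]` to `[x, κγ, i] = [x, γ, i] · (γ⁻¹κγ)`. From there the
lift of `c'` is the translate by `γ⁻¹κγ` of its lift from `[x, γ, i]`. -/
theorem holMap_act {q q' : HolCover A i x} {κ : A.Hol i x} (h : HolCover.IsAct q κ q') :
    S.holMap γ q' = S.act (S.holMap γ q) (S.conjHol i x γ κ) := by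
  obtain ⟨c, y, c', hc, rfl, rfl⟩ := h
  refine S.holMap_mk γ ((S.liftTo_of_isHol hc γ).symm.trans ?_)
  rw [← act_point_conjHol]
  exact (S.liftTo_holMap γ c').act _

-- A loop with holonomy `κ` gives existence. By `holMap_act`, the image of the result under the
-- injective map `holMap` depends only on `q` and `κ`, which gives uniqueness.
include γ in
theorem existsUnique_isAct (q : HolCover A i x) (κ : A.Hol i x) :
    ∃! q', HolCover.IsAct q κ q' := by
  obtain ⟨y, c', rfl⟩ := exists_mk q
  obtain ⟨c, hc⟩ := S.exists_isHol γ κ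
  refine ⟨HolCover.mk (c.symm.trans c'), ⟨c, y, c', hc, rfl, rfl⟩, fun q' hq' => ?_⟩
  refine S.holMap_injective γ ?_
  rw [S.holMap_act γ hq', S.holMap_act γ ⟨c, y, c', hc, rfl, rfl⟩]

end Holonomy

end Gen

end RegularAtlas

/-! ### Topology of the holonomy covering -/

namespace RegularAtlas

variable {X : Type u} [TopologicalSpace X] {n : ℕ} {ι : Type v}
  {T : ι → Type w} [∀ i, TopologicalSpace (T i)] {A : RegularAtlas X n ι T}

namespace Gen

variable (S : A.Gen) {u₀ : Σ i, T i} {i : ι} {x : A.U i}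
  (γ : GermHom S.closure u₀ (A.p i x))

theorem liftTo_refl (z : S.Space u₀) :
    S.LiftTo z z (Path.refl (X := A.LeafSpace) (S.proj u₀ z)) :=
  ⟨ContinuousMap.const _ z, rfl, rfl, fun _ => rfl⟩

theorem continuous_holMap : Continuous (S.holMap γ) := by
  refine continuous_def.2 fun V hV => isOpen_iff_forall_mem_open.2 fun q hq => ?_
  obtain ⟨y, c, rfl⟩ := exists_mk q
  have hq : S.holMap γ (HolCover.mk c) ∈ V := hq
  have hw := S.liftTo_holMap γ c
  obtain ⟨j, x', δ, h, hwe⟩ := S.exists_pt (S.holMap γ (HolCover.mk c))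
  rw [hwe] at hw
  obtain rfl : x'.1 = y := hw.proj_end
  let V' : Set (S.LeafSpace u₀) := V ∩ S.plaque u₀ (j, δ)
  have hV' : IsOpen V' := hV.inter (S.isOpen_leaf_plaque (j, δ))
  -- Paths in `W` stay in a plaque of `X`, so their lifts stay in the plaque of `δ`; there a point
  -- is determined by its projection, hence the ends of the lifts lie in `V`.
  let W : Set A.LeafSpace := S.proj u₀ '' V'
  have hW : IsOpen W := S.isCoveringMap_proj.isOpenMap _ hV'
  have hWδ : ∀ r ∈ W, r ∈ A.plaque δ.1 := by
    rintro _ ⟨_, ⟨-, ⟨a, ha, rfl⟩⟩, rfl⟩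
    exact (show A.p j a = δ.1 from ha) ▸ A.mem_plaque_p a
  have hxW : x'.1 ∈ W := ⟨_, ⟨hq, x', h, hwe⟩, by rw [hwe]; rfl⟩
  refine ⟨{q | ∃ (z : X) (d : A.LeafPath x'.1 z), (∀ r, d.toFun r ∈ W) ∧
    q = HolCover.mk (c.trans d)}, ?_,
    TopologicalSpace.isOpen_generateFrom_of_mem ⟨x'.1, c, W, hW, hxW, rfl⟩, ?_⟩
  · rintro _ ⟨z, d, hd, rfl⟩
    have hz : z ∈ W := by
      have h1 := hd 1
      rwa [show d.toFun 1 = z from d.target'] at h1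
    obtain ⟨_, ⟨hv, ⟨a, ha, rfl⟩⟩, rfl⟩ := hz
    have h1 := hw.trans (S.liftTo_pt (y := a) (c := d) (fun r => hWδ _ (hd r)) h ha)
    have hv' : S.holMap γ (HolCover.mk (c.trans d)) ∈ V := mem_of_eq_of_mem (S.holMap_mk γ h1) hv
    exact hv'
  · refine ⟨x'.1, Path.refl (X := A.LeafSpace) x'.1, fun r => hxW, S.holMap_injective γ ?_⟩
    rw [hwe]
    exact (S.holMap_mk γ (hw.trans (S.liftTo_refl _))).symm

/-- Near the end of a lift, every point of its plaque is reached by prolonging the path inside `W`,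
since leaves are locally path connected. -/
theorem isOpen_image_holMap {y : X} (c : A.LeafPath x.1 y) {W : Set A.LeafSpace}
    (hW : IsOpen W) :
    IsOpen (X := S.LeafSpace u₀) (S.holMap γ '' {q | ∃ (z : X) (d : A.LeafPath y z),
      (∀ r, d.toFun r ∈ W) ∧ q = HolCover.mk (c.trans d)}) := by
  refine isOpen_iff_forall_mem_open.2 ?_
  rintro _ ⟨_, ⟨z, d, hd, rfl⟩, rfl⟩
  have hw := S.liftTo_holMap γ (c.trans d)
  obtain ⟨j, x', δ, h, hwe⟩ :=
    S.exists_pt (S.holMap γ (HolCover.mk (c.trans d)))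
  rw [hwe] at hw
  obtain rfl : x'.1 = z := hw.proj_end
  have hz : x'.1 ∈ W := by
    have h1 := hd 1
    rwa [show d.toFun 1 = x'.1 from d.target'] at h1
  have hz' : x'.1 ∈ A.plaque δ.1 := h ▸ A.mem_plaque_p x'
  obtain ⟨W', hW', hxW', hWδ, hj⟩ := A.exists_joinedIn_nhds
    (hW.inter (A.isOpen_leaf_plaque δ.1)) hz' ⟨hz, hz'⟩
  refine ⟨S.proj u₀ ⁻¹' W' ∩ S.plaque u₀ (j, δ), ?_,
    (hW'.preimage S.continuous_proj_leaf).inter (S.isOpen_leaf_plaque (j, δ)), ?_⟩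
  · rintro _ ⟨ha, ⟨a, haδ, rfl⟩⟩
    obtain ⟨e, he⟩ := hj a.1 ha
    have h1 := S.liftTo_pt (y := a) (c := e) (fun r => (he r).2) h haδ
    -- Basic open sets require the form `c (d e)`, which is not the same path as `(c d) e`; so the
    -- lifts of the three pieces are composed again in this order.
    have h2 : S.LiftTo (S.point i x γ) (S.pt j a δ haδ)
        (c.trans (d.trans e)) := by
      obtain ⟨v, hv⟩ := S.exists_liftTo (z := S.point i x γ) rfl c
      obtain ⟨v', hv'⟩ := S.exists_liftTo hv.proj_end d
      obtain rfl := (hv.trans hv').unique hw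
      exact hv.trans (hv'.trans h1)
    refine ⟨_, ⟨a.1, d.trans e, fun r => ?_, rfl⟩, S.holMap_mk γ h2⟩
    have hr := Path.trans_apply (X := A.LeafSpace) d e r
    change (d.trans e).toFun r = _ at hr
    rw [hr]
    split_ifs
    · exact hd _
    · exact (he _).1
  · refine ⟨?_, x', h, hwe⟩
    rw [hwe]
    exact hxW'

/-- By injectivity each generating open set of the holonomy covering is the preimage of its image,
which is open. -/
theorem isEmbedding_holMap : IsEmbedding (S.holMap γ) := by
  refine ⟨⟨le_antisymm (S.continuous_holMap γ).le_induced ?_⟩, S.holMap_injective γ⟩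
  refine le_generateFrom ?_
  rintro N ⟨y, c, W, hW, -, rfl⟩
  exact ⟨_, S.isOpen_image_holMap γ c hW, preimage_image_eq _ (S.holMap_injective γ)⟩

/-- The holonomy covering of a leaf is identified with the leaves of the Molino space above it. -/
theorem equivariantInclusion :
    S.EquivariantInclusion i x (S.point i x γ) (S.conjHol i x γ) :=
  ⟨S.existsUnique_isAct γ, S.holMap γ, S.isEmbedding_holMap γ, S.range_holMap γ, S.holMap_base γ,
    S.proj_holMap γ, fun _ _ _ h => S.holMap_act γ h⟩

theorem conjHol_one : S.conjHol i x (1 : GermHom S.closure (A.p i x) (A.p i x)) =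
    S.inclHol i x := by
  ext κ
  change (1 : S.H (A.p i x))⁻¹ * (S.inclHol i x κ * 1) = _
  group

end Gen

end RegularAtlas

/-! ### Equicontinuity in one metric and limits of maps -/

theorem exists_pos_forall_of_finite {α : Type*} {s : Set α} (hs : s.Finite) {P : α → ℝ → Prop}
    (mono : ∀ a δ δ', 0 < δ' → δ' ≤ δ → P a δ → P a δ') (h : ∀ a ∈ s, ∃ δ > 0, P a δ) :
    ∃ δ > 0, ∀ a ∈ s, P a δ := by
  induction s, hs using Set.Finite.induction_on with
  | empty => exact ⟨1, one_pos, fun _ ha => ha.elim⟩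
  | @insert a s _ _ ih =>
    obtain ⟨δ, hδ, h1⟩ := ih fun b hb => h b (mem_insert_of_mem _ hb)
    obtain ⟨δ', hδ', h2⟩ := h a (mem_insert _ _)
    refine ⟨min δ δ', lt_min hδ hδ', ?_⟩
    rintro b (rfl | hb)
    · exact mono _ _ _ (lt_min hδ hδ') (min_le_right _ _) h2
    · exact mono _ _ _ (lt_min hδ hδ') (min_le_left _ _) (h1 b hb)

/-- Only `q` ranges over the compact set; `y` is an arbitrary nearby point. This is what comparing
two metrics near a compact set requires. -/
theorem exists_dist_lt_of_isCompact {Z : Type u} {W : Type v} [PseudoMetricSpace Z]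
    [PseudoMetricSpace W] {f : Z → W} (hf : Continuous f) {C : Set Z} (hC : IsCompact C) {ε : ℝ}
    (hε : 0 < ε) : ∃ δ > 0, ∀ q ∈ C, ∀ y, dist q y < δ → dist (f q) (f y) < ε := by
  have h := hC.uniformContinuousAt_of_continuousAt f (fun a _ => hf.continuousAt)
    (Metric.dist_mem_uniformity hε)
  obtain ⟨δ, hδ, h⟩ := Metric.mem_uniformity_dist.1 h
  exact ⟨δ, hδ, fun q hq y hy => h hy hq⟩

section

variable {T : Type u} [MetricSpace T]

/-- Equicontinuity, expressed with a single metric near a compact set. -/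
theorem IsEquicontinuous.exists_dist_lt [LocallyCompactSpace T]
    {S : Set (OpenPartialHomeomorph T T)} (hS : IsEquicontinuous S) {Q : Set T}
    (hQ : IsCompact Q) :
    ∃ η > 0, ∀ ε > 0, ∃ δ > 0, ∀ s ∈ S, ∀ x ∈ Q, x ∈ s.source → s x ∈ Q → ∀ y ∈ s.source,
      dist x y < δ → dist (s x) (s y) < η → dist (s x) (s y) < ε := by
  obtain ⟨κ, V, d, hV, hcov, hd, hequi⟩ := hS
  have h0 : ∀ q : T, ∃ k, ∃ C, IsCompact C ∧ q ∈ interior C ∧ C ⊆ V k := fun q => by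
    have : q ∈ ⋃ k, V k := hcov ▸ mem_univ q
    obtain ⟨k, hk⟩ := mem_iUnion.1 this
    obtain ⟨C, hC, h1, h2⟩ := exists_compact_subset (hV k) hk
    exact ⟨k, C, hC, h1, h2⟩
  choose k C hC hqC hCV using h0
  obtain ⟨t, -, ht⟩ := hQ.elim_nhds_subcover (fun q => interior (C q))
    fun q _ => isOpen_interior.mem_nhds (hqC q)
  have hmem : ∀ x ∈ Q, ∃ a ∈ t, x ∈ C a := fun x hx => by
    obtain ⟨a, ha, h⟩ := mem_iUnion₂.1 (ht hx)
    exact ⟨a, ha, interior_subset h⟩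
  have hC' : ∀ a, IsCompact (Subtype.val ⁻¹' C a : Set (V (k a))) := fun a =>
    IsInducing.subtypeVal.isCompact_preimage' (hC a) (by simpa using hCV a)
  -- The `η`-neighborhood of each compact piece stays in its chart `V`. The a priori bound `η` on
  -- `dist (s x) (s y)` puts `s y` in the chart of `s x`, where equicontinuity applies.
  obtain ⟨η, hη, hηV⟩ := exists_pos_forall_of_finite t.finite_toSet
    (P := fun a η => ∀ x ∈ C a, ∀ y, dist x y < η → y ∈ V (k a))
    (fun a δ δ' _ h1 h2 x hx y hy => h2 x hx y (hy.trans_le h1)) fun a _ => by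
      obtain ⟨δ, hδ, h⟩ := (hC a).exists_thickening_subset_open (hV _) (hCV a)
      refine ⟨δ, hδ, fun x hx y hy => h (Metric.mem_thickening_iff.2 ⟨x, hx, ?_⟩)⟩
      rwa [dist_comm]
  refine ⟨η, hη, fun ε hε => ?_⟩
  -- Chain of constants: `ε'` in a chart metric gives `ε` in the global one, equicontinuity turns
  -- `ε'` into `δ'`, and a global `δ` gives `δ'` in a chart metric.
  obtain ⟨ε', hε', h1⟩ := exists_pos_forall_of_finite t.finite_toSet
    (P := fun a ε' => ∀ x (hx : x ∈ C a) y (hy : y ∈ V (k a)),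
      (d (k a)).dist ⟨x, hCV a hx⟩ ⟨y, hy⟩ < ε' → dist x y < ε)
    (fun a δ δ' _ h1 h2 x hx y hy h => h2 x hx y hy (h.trans_le h1)) fun a _ => by
      obtain ⟨δ, hδ, h⟩ := @exists_dist_lt_of_isCompact (V (k a)) T (d (k a)).toPseudoMetricSpace _
        Subtype.val (by rw [hd]; exact continuous_subtype_val) (Subtype.val ⁻¹' C a)
        (by rw [hd]; exact hC' a) ε hε
      exact ⟨δ, hδ, fun x hx y hy hxy => h ⟨x, hCV a hx⟩ hx ⟨y, hy⟩ hxy⟩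
  obtain ⟨δ', hδ', h2⟩ := hequi ε' hε'
  obtain ⟨δ, hδ, h3⟩ := exists_pos_forall_of_finite t.finite_toSet
    (P := fun a δ => ∀ x (hx : x ∈ C a) y (hy : y ∈ V (k a)), dist x y < δ →
      (d (k a)).dist ⟨x, hCV a hx⟩ ⟨y, hy⟩ < δ')
    (fun a δ δ' _ h1 h2 x hx y hy h => h2 x hx y hy (h.trans_le h1)) fun a _ => by
      obtain ⟨δ, hδ, h⟩ := @exists_dist_lt_of_isCompact (V (k a)) (V (k a)) _
        (d (k a)).toPseudoMetricSpace id (by rw [hd]; exact continuous_id) (Subtype.val ⁻¹' C a)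
        (hC' a) δ' hδ'
      exact ⟨δ, hδ, fun x hx y hy hxy => h ⟨x, hCV a hx⟩ hx ⟨y, hy⟩ hxy⟩
  refine ⟨min δ η, lt_min hδ hη, fun s hs x hxQ hx hsx y hy hxy hsxy => ?_⟩
  obtain ⟨a, ha, hxa⟩ := hmem x hxQ
  obtain ⟨b, hb, hxb⟩ := hmem (s x) hsx
  have hya : y ∈ V (k a) := hηV a ha x hxa y (hxy.trans_le (min_le_right _ _))
  have hyb : s y ∈ V (k b) := hηV b hb _ hxb _ hsxy
  refine h1 b hb (s x) hxb (s y) hyb ?_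
  exact h2 s hs (k a) (k b) ⟨x, hCV a hxa⟩ ⟨y, hya⟩ hx hy (hCV b hxb) hyb
    (h3 a ha x hxa y hya (hxy.trans_le (min_le_left _ _)))

/-- Germs in `S` along a compact set have representatives in `S` on balls of uniform radius. -/
theorem exists_ball_subset_source {S : Set (OpenPartialHomeomorph T T)}
    {g : OpenPartialHomeomorph T T} {Q : Set T} (hQ : IsCompact Q)
    (h : ∀ t ∈ Q, ∃ f ∈ S, t ∈ f.source ∧ (f : T → T) =ᶠ[𝓝 t] g) {η : ℝ} (hη : 0 < η) :
    ∃ ε > 0, ∀ t ∈ Q, ∃ f ∈ S, Metric.ball t ε ⊆ f.source ∧ (f : T → T) =ᶠ[𝓝 t] g ∧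
      ∀ y ∈ Metric.ball t ε, dist (f t) (f y) < η := by
  refine hQ.induction_on (p := fun Q => ∃ ε > 0, ∀ t ∈ Q, ∃ f ∈ S, Metric.ball t ε ⊆ f.source ∧
    (f : T → T) =ᶠ[𝓝 t] g ∧ ∀ y ∈ Metric.ball t ε, dist (f t) (f y) < η)
    ⟨1, one_pos, fun _ h => h.elim⟩ ?_ ?_ fun t ht => ?_
  · rintro Q Q' hQQ' ⟨ε, hε, h⟩
    exact ⟨ε, hε, fun t ht => h t (hQQ' ht)⟩
  · rintro Q Q' ⟨ε, hε, h⟩ ⟨ε', hε', h'⟩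
    refine ⟨min ε ε', lt_min hε hε', ?_⟩
    rintro t (ht | ht)
    · obtain ⟨f, hf, h1, h2, h3⟩ := h t ht
      have hb := Metric.ball_subset_ball (x := t) (min_le_left ε ε')
      exact ⟨f, hf, hb.trans h1, h2, fun y hy => h3 y (hb hy)⟩
    · obtain ⟨f, hf, h1, h2, h3⟩ := h' t ht
      have hb := Metric.ball_subset_ball (x := t) (min_le_right ε ε')
      exact ⟨f, hf, hb.trans h1, h2, fun y hy => h3 y (hb hy)⟩
  · obtain ⟨f, hf, hts, hfg⟩ := h t ht
    have h1 : ∀ᶠ y in 𝓝 t, y ∈ f.source ∧ (f : T → T) =ᶠ[𝓝 y] g ∧ dist (f y) (f t) < η / 2 :=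
      (f.open_source.eventually_mem hts).and (hfg.eventually_nhds.and
        (Metric.tendsto_nhds.1 (f.continuousAt hts) _ (half_pos hη)))
    obtain ⟨ρ, hρ, h2⟩ := Metric.eventually_nhds_iff_ball.1 h1
    -- Half of the radius is left over for the centers `q` near `t`, and one representative `f`
    -- serves them all.
    refine ⟨_, mem_nhdsWithin_of_mem_nhds (Metric.ball_mem_nhds t (half_pos hρ)), ρ / 2,
      half_pos hρ, fun q hq => ⟨f, hf, ?_⟩⟩
    have hb : Metric.ball q (ρ / 2) ⊆ Metric.ball t ρ :=
      Metric.ball_subset_ball' (by linarith [Metric.mem_ball.1 hq])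
    have hqb := hb (Metric.mem_ball_self (half_pos hρ))
    refine ⟨fun y hy => (h2 y (hb hy)).1, (h2 q hqb).2.1, fun y hy => ?_⟩
    have h3 := (h2 q hqb).2.2
    have h4 := (h2 y (hb hy)).2.2
    linarith [dist_triangle_right (f q) (f y) (f t)]

/-- Limits along an ultrafilter of equicontinuous maps with values in a compact set. -/
theorem exists_limit_of_equicontinuous {Q B : Set T} (hQ : IsCompact Q) {s : ℕ → T → T}
    (hs : ∀ n, ∀ y ∈ B, s n y ∈ Q)
    (heq : ∀ ε > 0, ∃ δ > 0, ∀ n, ∀ y ∈ B, ∀ z ∈ B, dist y z < δ → dist (s n y) (s n z) < ε)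
    (l : Ultrafilter ℕ) :
    ∃ f : T → T, (∀ y ∈ B, Tendsto (fun n => s n y) l (𝓝 (f y))) ∧
      ∀ ε > 0, ∃ δ > 0, ∀ y ∈ B, ∀ z ∈ B, dist y z < δ → dist (f y) (f z) ≤ ε := by
  have h1 : ∀ y, ∃ z, y ∈ B → Tendsto (fun n => s n y) l (𝓝 z) := fun y => by
    by_cases hy : y ∈ B
    · obtain ⟨z, -, hz⟩ := hQ.ultrafilter_le_nhds (l.map fun n => s n y)
        (by rw [Ultrafilter.coe_map, le_principal_iff, mem_map]
            exact Eventually.of_forall fun n => hs n y hy)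
      exact ⟨z, fun _ => hz⟩
    · exact ⟨y, fun h => absurd h hy⟩
  choose f hf using h1
  refine ⟨f, hf, fun ε hε => ?_⟩
  obtain ⟨δ, hδ, h⟩ := heq ε hε
  refine ⟨δ, hδ, fun y hy z hz hyz => ?_⟩
  exact le_of_tendsto ((hf y hy).dist (hf z hz))
    (Eventually.of_forall fun n => (h n y hy z hz hyz).le)

theorem continuousOn_of_forall_dist_le {f : T → T} {B : Set T}
    (h : ∀ ε > 0, ∃ δ > 0, ∀ y ∈ B, ∀ z ∈ B, dist y z < δ → dist (f y) (f z) ≤ ε) :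
    ContinuousOn f B := by
  refine Metric.continuousOn_iff.2 fun z hz ε hε => ?_
  obtain ⟨δ, hδ, h⟩ := h (ε / 2) (half_pos hε)
  exact ⟨δ, hδ, fun y hy hyz => (h y hy z hz hyz).trans_lt (half_lt_self hε)⟩

/-- Limits of left inverses are left inverses of limits. -/
theorem tendsto_of_leftInverse {B : Set T} (hB : IsOpen B) {s s' : ℕ → T → T} {l : Filter ℕ}
    (heq : ∀ ε > 0, ∃ δ > 0, ∀ n, ∀ y ∈ B, ∀ z ∈ B, dist y z < δ → dist (s' n y) (s' n z) < ε)
    {y w : T} (hw : w ∈ B) (hy : Tendsto (fun n => s n y) l (𝓝 w))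
    (hinv : ∀ n, s n y ∈ B → s' n (s n y) = y) : Tendsto (fun n => s' n w) l (𝓝 y) := by
  refine Metric.tendsto_nhds.2 fun ε hε => ?_
  obtain ⟨δ, hδ, h⟩ := heq ε hε
  filter_upwards [Metric.tendsto_nhds.1 hy δ hδ, hy.eventually (hB.mem_nhds hw)] with n h1 h2
  have h3 := h n w hw (s n y) h2 (by rwa [dist_comm])
  rwa [hinv n h2] at h3

/-- A sequence of equicontinuous maps in `S` on a ball, whose inverses are equicontinuous on a ball,
has a limit in the closure of `S`. -/
theorem exists_mem_closureSet_of_equicontinuous {S : Set (OpenPartialHomeomorph T T)}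
    {Q B B' : Set T} (hQ : IsCompact Q) (hB : IsOpen B) (hB' : IsOpen B')
    {s s' : ℕ → OpenPartialHomeomorph T T} (hsS : ∀ n, s n ∈ S)
    (hsB : ∀ n, B ⊆ (s n).source) (hs : ∀ n, ∀ y ∈ B, s n y ∈ Q) (hs' : ∀ n, ∀ y ∈ B', s' n y ∈ Q)
    (heq : ∀ ε > 0, ∃ δ > 0, ∀ n, ∀ y ∈ B, ∀ z ∈ B, dist y z < δ → dist (s n y) (s n z) < ε)
    (heq' : ∀ ε > 0, ∃ δ > 0, ∀ n, ∀ y ∈ B', ∀ z ∈ B',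
      dist y z < δ → dist (s' n y) (s' n z) < ε)
    (hinv : ∀ n, ∀ y ∈ B, s n y ∈ B' → s' n (s n y) = y)
    (hinv' : ∀ n, ∀ y ∈ B', s' n y ∈ B → s n (s' n y) = y)
    {u v : T} (hu : u ∈ B) (hv : v ∈ B') (huv : Tendsto (fun n => s n u) atTop (𝓝 v)) :
    ∃ g ∈ closureSet S, u ∈ g.source ∧ g u = v := by
  -- Along an ultrafilter finer than `atTop`, maps with values in a compact set converge at all
  -- points at once, without passing to subsequences.
  let l : Ultrafilter ℕ := hyperfilter ℕ
  have hl : (l : Filter ℕ) ≤ atTop := Nat.hyperfilter_le_atTop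
  obtain ⟨f, hf, hfc⟩ := exists_limit_of_equicontinuous hQ hs heq l
  obtain ⟨f', hf', hfc'⟩ := exists_limit_of_equicontinuous hQ hs' heq' l
  have hcont := continuousOn_of_forall_dist_le hfc
  have hcont' := continuousOn_of_forall_dist_le hfc'
  have hff : ∀ y ∈ B, f y ∈ B' → f' (f y) = y := fun y hy hy' =>
    tendsto_nhds_unique (hf' _ hy')
      (tendsto_of_leftInverse hB' heq' hy' (hf y hy) fun n => hinv n y hy)
  have hff' : ∀ y ∈ B', f' y ∈ B → f (f' y) = y := fun y hy hy' =>
    tendsto_nhds_unique (hf _ hy')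
      (tendsto_of_leftInverse hB heq hy' (hf' y hy) fun n => hinv' n y hy)
  have hfu : f u = v := tendsto_nhds_unique (hf u hu) (huv.mono_left hl)
  let g : OpenPartialHomeomorph T T :=
    { toFun := f
      invFun := f'
      source := B ∩ f ⁻¹' B'
      target := B' ∩ f' ⁻¹' B
      map_source' := fun y hy => ⟨hy.2, by rw [mem_preimage, hff y hy.1 hy.2]; exact hy.1⟩
      map_target' := fun y hy => ⟨hy.2, by rw [mem_preimage, hff' y hy.1 hy.2]; exact hy.1⟩
      left_inv' := fun y hy => hff y hy.1 hy.2
      right_inv' := fun y hy => hff' y hy.1 hy.2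
      open_source := hcont.isOpen_inter_preimage hB hB'
      open_target := hcont'.isOpen_inter_preimage hB' hB
      continuousOn_toFun := hcont.mono inter_subset_left
      continuousOn_invFun := hcont'.mono inter_subset_left }
  have hgB : g.source ⊆ B := inter_subset_left
  refine ⟨g, ?_, ⟨hu, by rw [mem_preimage, hfu]; exact hv⟩, hfu⟩
  let F : ℕ → C(g.source, T) := fun n =>
    ⟨g.source.domRestrict (s n), ((s n).continuousOn.mono (hgB.trans (hsB n))).domRestrict⟩
  refine mem_closure_of_tendsto (f := F) (b := (l : Filter ℕ)) ?_
    (Eventually.of_forall fun n => ⟨s n, hsS n, hgB.trans (hsB n), fun _ => rfl⟩)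
  refine ContinuousMap.tendsto_of_tendstoLocallyUniformly
    (Metric.tendstoLocallyUniformly_iff.2 fun ε hε y => ?_)
  -- Three terms: variation of the limit, convergence at the fixed point `y`, and variation of `s
  -- n`. Pointwise convergence thereby becomes locally uniform, hence convergence in the
  -- compact-open topology.
  obtain ⟨δ, hδ, h1⟩ := heq (ε / 3) (by positivity)
  obtain ⟨δ', hδ', h2⟩ := hfc (ε / 3) (by positivity)
  refine ⟨_, Metric.ball_mem_nhds y (lt_min hδ hδ'), ?_⟩
  filter_upwards [Metric.tendsto_nhds.1 (hf y (hgB y.2)) (ε / 3) (by positivity)] with n hn z hz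
  have hz1 : dist (z : T) y < min δ δ' := hz
  have h3 := h1 n z (hgB z.2) y (hgB y.2) (hz1.trans_le (min_le_left _ _))
  have h4 := h2 z (hgB z.2) y (hgB y.2) (hz1.trans_le (min_le_right _ _))
  change dist (f z) (s n z) < ε
  have h5 := dist_triangle4 (f z) (f y) (s n y) (s n z)
  rw [dist_comm (f y) (s n y), dist_comm (s n y) (s n z)] at h5
  linarith

end

theorem locallyCompactSpace_sigma {ι : Type*} {T : ι → Type*} [∀ i, TopologicalSpace (T i)]
    [∀ i, LocallyCompactSpace (T i)] : LocallyCompactSpace (Σ i, T i) := by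
  refine ⟨fun ⟨i, a⟩ N hN => ?_⟩
  obtain ⟨K, hK, hKN, hKc⟩ := local_compact_nhds (continuous_sigmaMk.continuousAt hN)
  exact ⟨_, isOpenMap_sigmaMk.image_mem_nhds hK, image_subset_iff.2 hKN,
    hKc.image continuous_sigmaMk⟩

/-! ### Germs represented by the generating set -/

section

variable {T : Type u} [TopologicalSpace T] {G : StructureGroupoid T}

theorem symm_eventuallyEq {g h : OpenPartialHomeomorph T T} (hg : g ∈ G) (hh : h ∈ G) {x : T}
    (hxg : x ∈ g.source) (hxh : x ∈ h.source) (e : (g : T → T) =ᶠ[𝓝 x] h) :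
    (g.symm : T → T) =ᶠ[𝓝 (g x)] h.symm := by
  have h1 : germ g hg hxg rfl = germ h hh hxh e.eq_of_nhds.symm := germ_eq_iff.2 e
  exact Quotient.exact (congrArg GermHom.inv h1)

theorem sigma_germ_eventuallyEq {x y y' : T} {g h : OpenPartialHomeomorph T T} {hg : g ∈ G}
    {hh : h ∈ G} {hxg : x ∈ g.source} {hxh : x ∈ h.source} {hy : g x = y} {hy' : h x = y'}
    (e : (⟨y, germ g hg hxg hy⟩ : Σ t, GermHom G x t) = ⟨y', germ h hh hxh hy'⟩) :
    (g : T → T) =ᶠ[𝓝 x] h := by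
  obtain rfl : y = y' := congrArg Sigma.fst e
  exact germ_eq_iff.1 (eq_of_heq (Sigma.mk.inj e).2)

theorem IsQuasiAnalytic.eqOn_id {S : Set (OpenPartialHomeomorph T T)} (hS : IsQuasiAnalytic S)
    {h : OpenPartialHomeomorph T T} (hh : h ∈ S) {t : T} (ht : t ∈ h.source)
    (e : (h : T → T) =ᶠ[𝓝 t] id) : EqOn h id h.source := by
  obtain ⟨O, hO, hOo, htO⟩ := eventually_nhds_iff.1 (e.and (h.open_source.eventually_mem ht))
  exact hS h hh O hOo ⟨t, htO⟩ (fun y hy => (hO y hy).2) fun y hy => (hO y hy).1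

/-- Every germ of a pseudogroup is the germ of an element of the generating set or of the
identity. -/
theorem GeneratingSet.exists_eventuallyEq_or (S : GeneratingSet G)
    {g : OpenPartialHomeomorph T T} (hg : g ∈ G) {t : T} (ht : t ∈ g.source) :
    (∃ s ∈ S.carrier, t ∈ s.source ∧ (s : T → T) =ᶠ[𝓝 t] g) ∨ (g : T → T) =ᶠ[𝓝 t] id := by
  rw [← S.generates] at hg
  refine generatedBy_induction (P := fun g t => (∃ s ∈ S.carrier, t ∈ s.source ∧
    (s : T → T) =ᶠ[𝓝 t] g) ∨ (g : T → T) =ᶠ[𝓝 t] id) ?_ ?_ ?_ ?_ ?_ hg ht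
  · exact fun g hg x hx => Or.inl ⟨g, hg, hx, EventuallyEq.rfl⟩
  · exact fun x => Or.inr EventuallyEq.rfl
  · rintro g hg x hx (⟨s, hs, hxs, e⟩ | e)
    · refine Or.inl ⟨s.symm, S.symm_mem s hs, ?_, ?_⟩
      · rw [← e.eq_of_nhds]
        exact s.map_source hxs
      · rw [← e.eq_of_nhds]
        exact symm_eventuallyEq (subset_generatedBy _ hs) hg hxs hx e
    · exact Or.inr (symm_eventuallyEq (h := OpenPartialHomeomorph.refl T) hg
        (generatedBy S.carrier).id_mem hx (mem_univ x) e)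
  · rintro g hg h hh x hx hgx hPg hPh
    have hc : Tendsto g (𝓝 x) (𝓝 (g x)) := (g.continuousAt hx).tendsto
    rcases hPg with ⟨s, hs, hxs, e⟩ | e <;> rcases hPh with ⟨s', hs', hxs', e'⟩ | e'
    · refine Or.inl ⟨s.trans s', S.trans_mem s hs s' hs', ?_, ?_⟩
      · rw [OpenPartialHomeomorph.trans_source]
        exact ⟨hxs, by rw [mem_preimage, e.eq_of_nhds]; exact hxs'⟩
      · filter_upwards [e, hc.eventually e'] with y h1 h2
        simp [h1, h2]
    · refine Or.inl ⟨s, hs, hxs, ?_⟩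
      filter_upwards [e, hc.eventually e'] with y h1 h2
      simpa [h1] using h2.symm
    · have hgx' : g x = x := e.eq_of_nhds
      refine Or.inl ⟨s', hs', by rwa [hgx'] at hxs', ?_⟩
      filter_upwards [e, hc.eventually e'] with y h1 h2
      have h1 : g y = y := h1
      rw [h1] at h2
      simp [h1, h2]
    · refine Or.inr ?_
      filter_upwards [e, hc.eventually e'] with y h1 h2
      exact h2.trans h1
  · rintro g hg h hh x hx hx' e (⟨s, hs, hxs, e'⟩ | e')
    · exact Or.inl ⟨s, hs, hxs, e'.trans e⟩
    · exact Or.inr (e.symm.trans e')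

/-- If some `s ∈ S` is defined at `t`, the composite of `s` and `s⁻¹` belongs to `S` and represents
the identity germ, so the exceptional case disappears. -/
theorem GeneratingSet.exists_eventuallyEq (S : GeneratingSet G)
    {g : OpenPartialHomeomorph T T} (hg : g ∈ G) {t : T} (ht : t ∈ g.source)
    (hS : ∃ s ∈ S.carrier, t ∈ s.source) :
    ∃ s ∈ S.carrier, t ∈ s.source ∧ (s : T → T) =ᶠ[𝓝 t] g := by
  rcases S.exists_eventuallyEq_or hg ht with h | e
  · exact h
  · obtain ⟨s, hs, hts⟩ := hS
    refine ⟨s.trans s.symm, S.trans_mem s hs _ (S.symm_mem s hs), ?_, ?_⟩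
    · rw [OpenPartialHomeomorph.trans_source]
      exact ⟨hts, s.map_source hts⟩
    · exact EventuallyEq.trans (s.eventually_left_inverse hts) e.symm

end

/-! ### Dense orbits and controlled representatives -/

namespace RegularAtlas

variable {X : Type u} [TopologicalSpace X] {n : ℕ} {ι : Type v}
  {T : ι → Type w} [∀ i, TopologicalSpace (T i)] {A : RegularAtlas X n ι T}

/-- In a minimal foliated space, the holonomy orbits are dense. -/
theorem exists_holonomy_of_isMinimal (hmin : A.IsMinimal) (u : Σ i, T i) {N : Set X}
    (hN : IsOpen N) (hne : N.Nonempty) :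
    ∃ y ∈ N, ∀ i (hi : y ∈ A.U i), ∃ g ∈ A.holonomy, u ∈ g.source ∧ g u = A.p i ⟨y, hi⟩ := by
  obtain ⟨k, x, rfl⟩ := A.exists_p_eq u
  -- The points whose transverse coordinates all lie in the orbit of `u`. This set is saturated by
  -- plaques, hence contains the dense leaf through `x`.
  let R : Set A.LeafSpace :=
    {y | ∀ i (hi : y ∈ A.U i), ∃ g ∈ A.holonomy, A.p k x ∈ g.source ∧
      g (A.p k x) = A.p i ⟨y, hi⟩}
  have hR : IsClopen R := by
    refine isClopen_of_saturated (Y := A.LeafSpace) A.isOpen_leaf_plaque A.exists_mem_plaque ?_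
    rintro ⟨j, t⟩ y hy z hz hyR i hi
    obtain ⟨hyj, hyt⟩ := A.mem_plaque_iff.1 hy
    obtain ⟨hzj, hzt⟩ := A.mem_plaque_iff.1 hz
    obtain ⟨g, hg, hxg, hgx⟩ := hyR j hyj
    have h1 : g (A.p k x) = A.p j ⟨z, hzj⟩ := hgx.trans (hyt.trans hzt.symm)
    refine ⟨g.trans (A.h i j), A.holonomy.trans hg (A.h_mem i j), ?_, ?_⟩
    · rw [OpenPartialHomeomorph.trans_source]
      exact ⟨hxg, by rw [mem_preimage, h1]; exact mem_h_source (A := A) hi hzj⟩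
    · rw [OpenPartialHomeomorph.coe_trans, Function.comp_apply, h1]
      exact h_apply (A := A) hi hzj
  have hx : x.1 ∈ R := fun i hi =>
    ⟨A.h i k, A.h_mem i k, mem_h_source (A := A) hi x.2, h_apply (A := A) hi x.2⟩
  obtain ⟨y, hyN, hy⟩ := (hmin x.1).inter_open_nonempty N hN hne
  exact ⟨y, hyN, hR.connectedComponent_subset hx hy⟩

/-- Every germ of the holonomy pseudogroup has a representative in `S` which is defined on a
neighborhood of controlled size, if the elementary holonomy transformations have representatives of
this kind and `S` is equicontinuous. -/
theorem exists_controlled_representative {S : A.Gen} {O K : ι → Set X} (hO : ∀ i, IsOpen (O i))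
    (hcov : ∀ x, ∃ i, x ∈ O i) (hOK : ∀ i, O i ⊆ K i) (hKU : ∀ i, K i ⊆ A.U i)
    {Q : Set (Σ i, T i)} (hQ : ∀ i x (hx : x ∈ K i), A.p i ⟨x, hKU i hx⟩ ∈ Q)
    {B B' B'' : (Σ i, T i) → Set (Σ i, T i)} (hB : ∀ t, t ∈ B t) (hBB' : ∀ t, B t ⊆ B' t)
    (hh : ∀ i j x (_ : x ∈ K i) (hj : x ∈ K j), ∃ f ∈ S.carrier,
      B' (A.p j ⟨x, hKU j hj⟩) ⊆ f.source ∧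
      (f : (Σ i, T i) → Σ i, T i) =ᶠ[𝓝 (A.p j ⟨x, hKU j hj⟩)] A.h i j ∧
      ∀ y ∈ B' (A.p j ⟨x, hKU j hj⟩), f y ∈ B'' (f (A.p j ⟨x, hKU j hj⟩)))
    (hS : ∀ s ∈ S.carrier, ∀ t ∈ Q, t ∈ s.source → s t ∈ Q → ∀ y ∈ s.source,
      y ∈ B t → s y ∈ B'' (s t) → s y ∈ B' (s t))
    {i j : ι} {x y : X} (hx : x ∈ K i) (hy : y ∈ K j)
    {g : OpenPartialHomeomorph (Σ i, T i) (Σ i, T i)} (hg : g ∈ A.holonomy)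
    (hxg : A.p i ⟨x, hKU i hx⟩ ∈ g.source)
    (hgy : g (A.p i ⟨x, hKU i hx⟩) = A.p j ⟨y, hKU j hy⟩) :
    ∃ s ∈ S.carrier, B (A.p i ⟨x, hKU i hx⟩) ⊆ s.source ∧
      (∀ y ∈ B (A.p i ⟨x, hKU i hx⟩), s y ∈ B' (s (A.p i ⟨x, hKU i hx⟩))) ∧
      (s : (Σ i, T i) → Σ i, T i) =ᶠ[𝓝 (A.p i ⟨x, hKU i hx⟩)] g := by
  set u := A.p i ⟨x, hKU i hx⟩ with hu
  have hucl : ∀ s ∈ S.carrier, s ∈ S.closure := fun s hs =>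
    subset_generatedBy _ (subset_closureSet _ hs)
  -- Continuation along leaves is a connectedness argument in the Molino space based at `u`: `R`
  -- consists of the points whose germ, in every chart `k` with projection in `K k`, has a
  -- controlled representative.
  let R : Set (S.LeafSpace u) := {z | ∀ k, S.proj u z ∈ K k →
    ∃ (s : OpenPartialHomeomorph (Σ i, T i) (Σ i, T i)) (hs : s ∈ S.carrier) (hus : u ∈ s.source),
      B u ⊆ s.source ∧ (∀ y ∈ B u, s y ∈ B' (s u)) ∧
        z ∈ S.plaque u (k, ⟨s u, germ s (hucl s hs) hus rfl⟩)}
  -- Plaques are cut down to `O k`, so that changes of chart happen only at points of the sets `K`,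
  -- where `hh` is available.
  let P : ι × GermFiber S.carrier u → Set (S.LeafSpace u) := fun k =>
    S.proj u ⁻¹' (O k.1) ∩ S.plaque u k
  have hPo : ∀ k, IsOpen (P k) := fun k =>
    ((A.isOpen_leaf_of_isOpen (hO k.1)).preimage S.continuous_proj_leaf).inter
      (S.isOpen_leaf_plaque k)
  have hPc : ∀ z, ∃ k, z ∈ P k := fun z => by
    obtain ⟨k, hk⟩ := hcov (S.proj u z)
    obtain ⟨δ, h, e⟩ := S.exists_pt_of_mem z (hKU k (hOK k hk))
    exact ⟨(k, δ), hk, _, h, e⟩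
  have huQ : u ∈ Q := hQ i x hx
  have hR : IsClopen R := by
    refine isClopen_of_saturated hPo hPc ?_
    rintro ⟨k, δ⟩ z ⟨hzO, ⟨a, ha, rfl⟩⟩ z' ⟨hzO', ⟨b, hb, rfl⟩⟩ hzR l hl
    obtain ⟨s, hs, hus, hBs, hsB, hz⟩ := hzR k (hOK k hzO)
    have hδ : δ = ⟨s u, germ s (hucl s hs) hus rfl⟩ := S.pt_mem_plaque.1 hz
    -- Within the plaque the representative `s` does not change. Passing to chart `l` composes it
    -- with `f`, which is defined on `B'` and so on the image of `B u`.
    subst hδ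
    have hbk : b.1 ∈ K k := hOK k hzO'
    have hbl : b.1 ∈ K l := hl
    have hb' : A.p k b = s u := hb
    obtain ⟨f, hf, hfB, hfe, hfB'⟩ := hh l k b.1 hbl hbk
    have hb'' : A.p k ⟨b.1, hKU k hbk⟩ = s u := hb
    rw [hb''] at hfB hfe hfB'
    have hsf : s u ∈ f.source := hfB (hBB' _ (hB _))
    have hus' : u ∈ (s.trans f).source := by
      rw [OpenPartialHomeomorph.trans_source]; exact ⟨hus, hsf⟩
    have hfs : f (s u) = A.p l ⟨b.1, hKU l hbl⟩ :=
      hfe.eq_of_nhds.trans ((congrArg (A.h l k) hb''.symm).trans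
        (h_apply (hKU l hbl) (hKU k hbk)))
    have hBsf : B u ⊆ (s.trans f).source := fun y hy => by
      rw [OpenPartialHomeomorph.trans_source]
      exact ⟨hBs hy, hfB (hsB y hy)⟩
    refine ⟨s.trans f, S.trans_mem s hs f hf, hus', hBsf, fun y hy => ?_, ?_⟩
    -- A priori the composite maps `B u` only into `B''`; since it is again in `S`, equicontinuity
    -- improves this to `B'`, and the domain `B u` is kept.
    · refine hS (s.trans f) (S.trans_mem s hs f hf) u huQ hus' ?_ y (hBsf hy) hy
        (hfB' _ (hsB y hy))
      change f (s u) ∈ Q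
      rw [hfs]
      exact hQ l _ hbl
    · refine (S.pt_mem_plaque_iff b.2 (hKU l hbl) hb).2 ?_
      refine (sigma_germ_eq (g' := f) (hg' := hucl f hf) (hy' := hsf) (hz' := rfl) hfe.symm _).trans
        ?_
      rfl
  have hz₀ : S.point i ⟨x, hKU i hx⟩ (GermHom.one S.closure u) ∈ R := by
    intro k hk
    have hxk : x ∈ K k := hk
    obtain ⟨f, hf, hfB, hfe, hfB'⟩ := hh k i x hxk hx
    have hBf : B u ⊆ f.source := (hBB' u).trans hfB
    refine ⟨f, hf, hBf (hB u), hBf, fun y hy => ?_, ?_⟩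
    · refine hS f hf u huQ (hBf (hB u)) ?_ y (hBf hy) hy (hfB' y (hBB' u hy))
      rw [hfe.eq_of_nhds, h_apply (hKU k hxk) (hKU i hx)]
      exact hQ k _ hxk
    · refine (S.pt_mem_plaque_iff (δ := ⟨u, GermHom.one S.closure u⟩) (hKU i hx) (hKU k hxk)
        rfl).2 ?_
      refine (sigma_germ_eq (g' := f) (hg' := hucl f hf) (hy' := hBf (hB u)) (hz' := rfl)
        hfe.symm _).trans ?_
      rw [GermHom.comp_one]
  -- The germ of `g` is in the leaf of the identity germ, hence in `R`.
  have hjoin := S.joined_hat hg (δ := ⟨u, GermHom.one S.closure u⟩) hxg (x := ⟨x, hKU i hx⟩)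
    (y := ⟨y, hKU j hy⟩) rfl hgy.symm
  have hmem := hR.connectedComponent_subset hz₀
    (pathComponent_subset_component (X := S.LeafSpace u) _ hjoin)
  obtain ⟨s, hs, hus, hBs, hsB, hz⟩ := hmem j hy
  refine ⟨s, hs, hBs, hsB, ?_⟩
  have h1 := S.pt_mem_plaque.1 hz
  have h2 : (⟨g u, germ g (S.le_closure hg) hxg rfl⟩ : GermFiber S.carrier u) =
      ⟨s u, germ s (hucl s hs) hus rfl⟩ := by
    rw [← h1]
    exact congrArg (Sigma.mk _) (GermHom.comp_one _).symm
  exact (sigma_germ_eventuallyEq h2).symm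

end RegularAtlas

/-! ### Transitivity of the closure -/

namespace RegularAtlas

variable {X : Type u} [TopologicalSpace X] {n : ℕ} {ι : Type v}
  {T : ι → Type w} [∀ i, TopologicalSpace (T i)] {A : RegularAtlas X n ι T}

/-- The closure of a minimal equicontinuous strongly quasi-analytic holonomy pseudogroup is
transitive, provided that the domains of the members of the generating set cover. -/
theorem exists_mem_closureSet [PolishSpace X] [CompactSpace X]
    [∀ i, PolishSpace (T i)] [∀ i, LocallyCompactSpace (T i)] (hmin : A.IsMinimal) {S : A.Gen}
    (hequi : IsEquicontinuous S.carrier) (hqa : IsQuasiAnalytic S.carrier)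
    (hdom : ∀ t, ∃ s ∈ S.carrier, t ∈ s.source) (u v : Σ i, T i) :
    ∃ g ∈ S.closure, u ∈ g.source ∧ g u = v := by
  let _ : MetricSpace (Σ i, T i) := TopologicalSpace.metrizableSpaceMetric _
  have : LocallyCompactSpace (Σ i, T i) := locallyCompactSpace_sigma
  obtain ⟨O, hOcov, hO, hOU⟩ := exists_iUnion_eq_closure_subset A.isOpen_U
    A.locallyFinite.point_finite A.cover
  have hcov : ∀ x, ∃ i, x ∈ O i := fun x => mem_iUnion.1 (hOcov ▸ mem_univ x)
  let K : ι → Set X := fun i => closure (O i)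
  have hOK : ∀ i, O i ⊆ K i := fun i => subset_closure
  have hJ : {i | (A.U i).Nonempty}.Finite := A.locallyFinite.finite_nonempty_of_compact
  have hrep : ∀ g ∈ A.holonomy, ∀ t ∈ g.source, ∃ f ∈ S.carrier, t ∈ f.source ∧
      (f : (Σ i, T i) → Σ i, T i) =ᶠ[𝓝 t] g := fun g hg t ht =>
    S.exists_eventuallyEq hg ht (hdom t)
  -- Reduction to points of the smaller open sets.
  suffices H : ∀ i x (hx : x ∈ O i) j y (hy : y ∈ O j), ∃ g ∈ S.closure,
      A.p i ⟨x, hOU i (hOK i hx)⟩ ∈ g.source ∧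
      g (A.p i ⟨x, hOU i (hOK i hx)⟩) = A.p j ⟨y, hOU j (hOK j hy)⟩ by
    obtain ⟨i, x, rfl⟩ := A.exists_p_eq u
    obtain ⟨j, y, rfl⟩ := A.exists_p_eq v
    obtain ⟨i', hi'⟩ := hcov x.1
    obtain ⟨j', hj'⟩ := hcov y.1
    obtain ⟨g, hg, hs, he⟩ := H i' x.1 hi' j' y.1 hj'
    have h1 : A.h i' i (A.p i x) = A.p i' ⟨x.1, hOU i' (hOK i' hi')⟩ := h_apply _ x.2
    have h2 : A.h j j' (A.p j' ⟨y.1, hOU j' (hOK j' hj')⟩) = A.p j y := h_apply y.2 _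
    refine ⟨((A.h i' i).trans g).trans (A.h j j'), S.closure.trans
      (S.closure.trans (S.le_closure (A.h_mem i' i)) hg) (S.le_closure (A.h_mem j j')), ?_, ?_⟩
    · rw [OpenPartialHomeomorph.trans_source, OpenPartialHomeomorph.trans_source]
      refine ⟨⟨mem_h_source (hOU i' (hOK i' hi')) x.2, by rwa [mem_preimage, h1]⟩, ?_⟩
      rw [mem_preimage, OpenPartialHomeomorph.coe_trans, Function.comp_apply, h1, he]
      exact mem_h_source y.2 (hOU j' (hOK j' hj'))
    · rw [OpenPartialHomeomorph.coe_trans, OpenPartialHomeomorph.coe_trans, Function.comp_apply,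
        Function.comp_apply, h1, he, h2]
  intro i x hx j y hy
  have hKp : ∀ i (C : Set X), IsCompact C → C ⊆ A.U i →
      IsCompact (A.p i '' (Subtype.val ⁻¹' C)) := fun i C hC hCU =>
    (IsInducing.subtypeVal.isCompact_preimage' hC (by simpa using hCU)).image (A.continuous_p i)
  -- A compact set that contains the images of all `K i`, and a compact neighborhood of it.
  obtain ⟨Q₀, hQ₀, hKQ₀⟩ : ∃ Q₀ : Set (Σ i, T i), IsCompact Q₀ ∧
      ∀ i x (hx : x ∈ K i), A.p i ⟨x, hOU i hx⟩ ∈ Q₀ :=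
    ⟨⋃ i ∈ {i | (A.U i).Nonempty}, A.p i '' (Subtype.val ⁻¹' K i),
      hJ.isCompact_biUnion fun i _ => hKp i _ isClosed_closure.isCompact (hOU i),
      fun i x hx => mem_biUnion (show i ∈ {i | (A.U i).Nonempty} from ⟨x, hOU i hx⟩) ⟨_, hx, rfl⟩⟩
  obtain ⟨Q, hQ, hQ₀Q⟩ := exists_compact_superset hQ₀
  obtain ⟨r, hr, hrQ⟩ := hQ₀.exists_thickening_subset_open isOpen_interior hQ₀Q
  have hball : ∀ t ∈ Q₀, ∀ ρ ≤ r, Metric.ball t ρ ⊆ Q := fun t ht ρ hρ y hy =>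
    interior_subset (hrQ (Metric.mem_thickening_iff.2
      ⟨t, ht, (Metric.mem_ball.1 hy).trans_le hρ⟩))
  have hQ₀Q' : Q₀ ⊆ Q := hQ₀Q.trans interior_subset
  obtain ⟨η, hη, hE⟩ := hequi.exists_dist_lt hQ
  obtain ⟨ε₀, hε₀, hM⟩ := exists_pos_forall_of_finite (hJ.prod hJ) (P := fun k ε =>
      ∀ t ∈ A.p k.2 '' (Subtype.val ⁻¹' (K k.1 ∩ K k.2)), ∃ f ∈ S.carrier,
        Metric.ball t ε ⊆ f.source ∧ (f : (Σ i, T i) → Σ i, T i) =ᶠ[𝓝 t] A.h k.1 k.2 ∧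
        ∀ y ∈ Metric.ball t ε, dist (f t) (f y) < η)
    (fun k δ δ' _ h1 h2 t ht => by
      obtain ⟨f, hf, h3, h4, h5⟩ := h2 t ht
      have hb := Metric.ball_subset_ball (x := t) h1
      exact ⟨f, hf, hb.trans h3, h4, fun y hy => h5 y (hb hy)⟩)
    (fun k _ => by
      refine exists_ball_subset_source (hKp k.2 _
        (isClosed_closure.isCompact.inter isClosed_closure.isCompact)
        (inter_subset_right.trans (hOU k.2))) ?_ hη
      rintro _ ⟨z, ⟨hz1, hz2⟩, rfl⟩
      exact hrep _ (A.h_mem _ _) _ (mem_h_source (hOU _ hz1) z.2))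
  -- The bound `ε₀` gives domains for the elementary representatives, `η / 2` makes any two points
  -- of an image ball closer than `η`, and `r` keeps balls centered in `Q₀` inside `Q`.
  let ε := min ε₀ (min (η / 2) r)
  have hε : 0 < ε := lt_min hε₀ (lt_min (half_pos hη) hr)
  have hεη : ε ≤ η / 2 := (min_le_right _ _).trans (min_le_left _ _)
  have hεr : ε ≤ r := (min_le_right _ _).trans (min_le_right _ _)
  obtain ⟨δ₀, hδ₀, hEδ⟩ := hE ε hε
  -- The bound `δ₀` comes from equicontinuity for `ε`; `δ ≤ ε` gives the inclusion of `B t` in `B'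
  -- t`.
  let δ := min δ₀ ε
  have hδ : 0 < δ := lt_min hδ₀ hε
  have hδε : δ ≤ ε := min_le_right _ _
  -- Controlled representatives.
  have key : ∀ {i j : ι} {x y : X} (hx : x ∈ K i) (hy : y ∈ K j)
      {g : OpenPartialHomeomorph (Σ i, T i) (Σ i, T i)}, g ∈ A.holonomy →
      A.p i ⟨x, hOU i hx⟩ ∈ g.source → g (A.p i ⟨x, hOU i hx⟩) = A.p j ⟨y, hOU j hy⟩ →
      ∃ s ∈ S.carrier, Metric.ball (A.p i ⟨x, hOU i hx⟩) δ ⊆ s.source ∧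
      (∀ y ∈ Metric.ball (A.p i ⟨x, hOU i hx⟩) δ,
        s y ∈ Metric.ball (s (A.p i ⟨x, hOU i hx⟩)) ε) ∧
      (s : (Σ i, T i) → Σ i, T i) =ᶠ[𝓝 (A.p i ⟨x, hOU i hx⟩)] g := by
    intro i j x y hx hy g hg hxg hgy
    refine exists_controlled_representative (B := fun t => Metric.ball t δ)
      (B' := fun t => Metric.ball t ε) (B'' := fun t => Metric.ball t η) hO hcov hOK hOU hKQ₀
      (fun t => Metric.mem_ball_self hδ) (fun t => Metric.ball_subset_ball hδε) ?_ ?_ hx hy hg hxg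
      hgy
    · intro i j x hi hj
      obtain ⟨f, hf, h1, h2, h3⟩ := hM (i, j) ⟨⟨x, hOU i hi⟩, ⟨x, hOU j hj⟩⟩
        (A.p j ⟨x, hOU j hj⟩) ⟨_, ⟨hi, hj⟩, rfl⟩
      have hb := Metric.ball_subset_ball (x := A.p j ⟨x, hOU j hj⟩)
        (show ε ≤ ε₀ from min_le_left _ _)
      exact ⟨f, hf, hb.trans h1, h2, fun y hy => Metric.mem_ball'.2 (h3 y (hb hy))⟩
    · intro s hs t ht hts hst y hy hyt hys
      exact Metric.mem_ball'.2 (hEδ s hs t (hQ₀Q' ht) hts (hQ₀Q' hst) y hy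
        ((Metric.mem_ball'.1 hyt).trans_le (min_le_left _ _)) (Metric.mem_ball'.1 hys))
  set u := A.p i ⟨x, hOU i (hOK i hx)⟩ with hu
  set v := A.p j ⟨y, hOU j (hOK j hy)⟩ with hv
  have huQ₀ : u ∈ Q₀ := hKQ₀ i x (hOK i hx)
  have hex : ∀ m : ℕ, ∃ s ∈ S.carrier, ∃ s' ∈ S.carrier,
      s u ∈ Q₀ ∧ dist (s u) v < 1 / (m + 1) ∧ dist (s u) v < δ / 2 ∧
      Metric.ball u δ ⊆ s.source ∧ (∀ z ∈ Metric.ball u δ, s z ∈ Metric.ball (s u) ε) ∧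
      Metric.ball (s u) δ ⊆ s'.source ∧ (∀ z ∈ Metric.ball (s u) δ, s' z ∈ Metric.ball u ε) ∧
      (∀ z ∈ (s.trans s').source, s' (s z) = z) ∧ (∀ z ∈ (s'.trans s).source, s (s' z) = z) := by
    intro m
    -- The term `1 / (m + 1)` makes `s u` converge to `v`; `δ / 2` puts a fixed ball around `v`
    -- inside every ball of radius `δ` around `s u`.
    let ρ : ℝ := min (1 / (m + 1)) (δ / 2)
    have hρ : 0 < ρ := lt_min (by positivity) (half_pos hδ)
    have hN : IsOpen (O j ∩ Subtype.val '' (A.p j ⁻¹' Metric.ball v ρ)) :=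
      (hO j).inter ((A.isOpen_U j).isOpenMap_subtype_val _
        (Metric.isOpen_ball.preimage (A.continuous_p j)))
    obtain ⟨z, ⟨hzO, ⟨⟨z', hz'U⟩, hzv, hzz'⟩⟩, hz⟩ := exists_holonomy_of_isMinimal hmin u hN
      ⟨y, hy, ⟨y, hOU j (hOK j hy)⟩, Metric.mem_ball_self hρ, rfl⟩
    obtain rfl : z' = z := hzz'
    obtain ⟨g, hg, hug, hgu⟩ := hz j hz'U
    have hgs : A.p j ⟨z', hz'U⟩ ∈ g.symm.source := hgu ▸ g.map_source hug
    have hgs' : g.symm (A.p j ⟨z', hz'U⟩) = u := by rw [← hgu, g.left_inv hug]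
    obtain ⟨s, hs, h1, h2, h3⟩ := key (hOK i hx) (hOK j hzO) hg hug hgu
    obtain ⟨s', hs', h1', h2', h3'⟩ := key (hOK j hzO) (hOK i hx) (A.holonomy.symm hg) hgs hgs'
    have hsu : s u = A.p j ⟨z', hz'U⟩ := h3.eq_of_nhds.trans hgu
    have hsu' : s' (s u) = u := by rw [hsu, h3'.eq_of_nhds, hgs']
    have hus : u ∈ s.source := h1 (Metric.mem_ball_self hδ)
    change Metric.ball (A.p j ⟨z', hz'U⟩) δ ⊆ s'.source at h1'
    change ∀ y ∈ Metric.ball (A.p j ⟨z', hz'U⟩) δ, s' y ∈ Metric.ball (s' (A.p j ⟨z', hz'U⟩)) ε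
      at h2'
    change (s' : (Σ i, T i) → Σ i, T i) =ᶠ[𝓝 (A.p j ⟨z', hz'U⟩)] g.symm at h3'
    rw [← hsu] at h1' h2' h3'
    rw [hsu'] at h2'
    have hsus' : s u ∈ s'.source := h1' (Metric.mem_ball_self hδ)
    have hdist : dist (s u) v < ρ := by rw [hsu]; exact hzv
    refine ⟨s, hs, s', hs', ?_, hdist.trans_le (min_le_left _ _),
      hdist.trans_le (min_le_right _ _), h1, h2, h1', h2', ?_, ?_⟩
    · rw [hsu]
      exact hKQ₀ j z' (hOK j hzO)
    -- The composite is in `S` and is the identity near `u`, as `s` and `s'` represent `g` and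
    -- `g⁻¹`; by quasi-analyticity it is the identity on its whole domain.
    · refine hqa.eqOn_id (S.trans_mem s hs s' hs') (t := u) ?_ ?_
      · rw [OpenPartialHomeomorph.trans_source]
        exact ⟨hus, hsus'⟩
      · filter_upwards [h3, (s.continuousAt hus).eventually h3', g.open_source.mem_nhds hug]
          with w hw hw' hw''
        change s' (s w) = w
        rw [hw', hw, g.left_inv hw'']
    · refine hqa.eqOn_id (S.trans_mem s' hs' s hs) (t := s u) ?_ ?_
      · rw [OpenPartialHomeomorph.trans_source]
        exact ⟨hsus', by rw [mem_preimage, hsu']; exact hus⟩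
      · have hc := s'.continuousAt hsus'
        rw [ContinuousAt, hsu'] at hc
        filter_upwards [h3', hc.eventually h3, g.open_target.mem_nhds (hsu ▸ hgs)]
          with w hw hw' hw''
        change s (s' w) = w
        rw [hw', hw, g.right_inv hw'']
  choose s hs s' hs' hsQ hsv hsv' h1 h2 h1' h2' h3 h3' using hex
  have hballv : ∀ m, Metric.ball v (δ / 2) ⊆ Metric.ball (s m u) δ := fun m =>
    Metric.ball_subset_ball' (by rw [dist_comm]; linarith [hsv' m])
  -- Values on `B` lie in a common ball of radius `ε ≤ η / 2`, which supplies the a priori bound `η`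
  -- required by `hE`.
  have hequi' : ∀ (f : ℕ → OpenPartialHomeomorph (Σ i, T i) (Σ i, T i)) (B : Set (Σ i, T i)),
      (∀ m, f m ∈ S.carrier) → (∀ m, B ⊆ (f m).source) → B ⊆ Q →
      (∀ m, ∃ t ∈ Q₀, ∀ z ∈ B, f m z ∈ Metric.ball t ε) →
      ∀ ε' > 0, ∃ δ' > 0, ∀ m, ∀ y ∈ B, ∀ z ∈ B, dist y z < δ' →
        dist (f m y) (f m z) < ε' := by
    intro f B hf hfB hBQ hft ε' hε'
    obtain ⟨δ', hδ', h⟩ := hE ε' hε'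
    refine ⟨δ', hδ', fun m y hy z hz hyz => ?_⟩
    obtain ⟨t, ht, htB⟩ := hft m
    refine h (f m) (hf m) y (hBQ hy) (hfB m hy) (hball t ht ε hεr (htB y hy)) z (hfB m hz) hyz ?_
    have h4 := Metric.mem_ball.1 (htB y hy)
    have h5 := Metric.mem_ball.1 (htB z hz)
    linarith [dist_triangle_right (f m y) (f m z) t]
  have huQ : Metric.ball u δ ⊆ Q := hball u huQ₀ δ (hδε.trans hεr)
  have hvQ₀ : v ∈ Q₀ := hKQ₀ j y (hOK j hy)
  have hvQ : Metric.ball v (δ / 2) ⊆ Q := hball v hvQ₀ _ (by linarith)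
  obtain ⟨g, hg, hug, hguv⟩ := exists_mem_closureSet_of_equicontinuous (B := Metric.ball u δ)
    (B' := Metric.ball v (δ / 2)) hQ Metric.isOpen_ball Metric.isOpen_ball hs h1
    (fun m z hz => hball _ (hsQ m) ε hεr (h2 m z hz))
    (fun m z hz => hball _ huQ₀ ε hεr (h2' m z (hballv m hz)))
    (hequi' s _ hs h1 huQ fun m => ⟨s m u, hsQ m, h2 m⟩)
    (hequi' s' _ hs' (fun m => (hballv m).trans (h1' m)) hvQ fun m =>
      ⟨u, huQ₀, fun z hz => h2' m z (hballv m hz)⟩)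
    (fun m z hz hz' => h3 m z (by
      rw [OpenPartialHomeomorph.trans_source]
      exact ⟨h1 m hz, h1' m (hballv m hz')⟩))
    (fun m z hz hz' => h3' m z (by
      rw [OpenPartialHomeomorph.trans_source]
      exact ⟨h1' m (hballv m hz), h1 m hz'⟩))
    (Metric.mem_ball_self hδ) (Metric.mem_ball_self (half_pos hδ))
    (tendsto_iff_dist_tendsto_zero.2 (squeeze_zero (fun _ => dist_nonneg)
      (fun m => (hsv m).le) tendsto_one_div_add_atTop_nhds_zero_nat))
  exact ⟨g, subset_generatedBy _ hg, hug, hguv⟩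

/-- A generating set need not be defined everywhere, because a pseudogroup contains the identity
anyway. A point `t` outside all domains is fixed by the holonomy; its orbit being dense, it is the
only point of the transversal, and the identity germ suffices. -/
theorem nonempty_germHom_closure [PolishSpace X] [CompactSpace X]
    [∀ i, PolishSpace (T i)] [∀ i, LocallyCompactSpace (T i)] (hmin : A.IsMinimal) {S : A.Gen}
    (hequi : IsEquicontinuous S.carrier) (hqa : IsQuasiAnalytic S.carrier) (u v : Σ i, T i) :
    Nonempty (GermHom S.closure u v) := by
  by_cases hdom : ∀ t, ∃ s ∈ S.carrier, t ∈ s.source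
  · obtain ⟨g, hg, hug, hguv⟩ := exists_mem_closureSet hmin hequi hqa hdom u v
    exact ⟨germ g hg hug hguv⟩
  · obtain ⟨t, ht⟩ := not_forall.1 hdom
    have hfix : ∀ g ∈ A.holonomy, t ∈ g.source → g t = t := fun g hg htg => by
      rcases S.exists_eventuallyEq_or hg htg with ⟨s, hs, hts, -⟩ | e
      · exact absurd ⟨s, hs, hts⟩ ht
      · exact e.eq_of_nhds
    have hall : ∀ w, w = t := by
      intro w
      by_contra hne
      obtain ⟨j, y, rfl⟩ := A.exists_p_eq w
      have hN : IsOpen (Subtype.val '' (A.p j ⁻¹' {t}ᶜ)) :=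
        (A.isOpen_U j).isOpenMap_subtype_val _ (isOpen_compl_singleton.preimage (A.continuous_p j))
      obtain ⟨z, ⟨⟨z, hzj⟩, hzt, rfl⟩, hz⟩ :=
        exists_holonomy_of_isMinimal hmin t hN ⟨y, y, hne, rfl⟩
      obtain ⟨g, hg, htg, hgt⟩ := hz j hzj
      exact hzt (hgt ▸ hfix g hg htg)
    obtain rfl := hall u
    obtain rfl := hall v
    exact ⟨GermHom.one _ _⟩

end RegularAtlas

end Molino

/-! ### The proposition -/

theorem mainTheorem6 {X : Type*} [TopologicalSpace X] [PolishSpace X] [CompactSpace X]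
    {n : ℕ} {ι : Type*} {T : ι → Type*} [∀ i, TopologicalSpace (T i)]
    [∀ i, PolishSpace (T i)] [∀ i, LocallyCompactSpace (T i)]
    (A : Molino.RegularAtlas X n ι T) (hmin : A.IsMinimal)
    (S : A.Gen) (hequi : Molino.IsEquicontinuous S.carrier)
    (hqa : Molino.IsQuasiAnalytic S.carrier)
    (hcl : Molino.StronglyQuasiAnalytic S.closure)
    (i₀ : ι) (x₀ : A.U i₀) :
    (Function.Injective (S.inclHol i₀ x₀) ∧
      Set.range (S.inclHol i₀ x₀) = S.leafStabilizer (S.point i₀ x₀ 1) ∧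
      S.EquivariantInclusion i₀ x₀ (S.point i₀ x₀ 1) (S.inclHol i₀ x₀)) ∧
    (∀ (i : ι) (x : A.U i),
      Nonempty (Molino.GermHom S.closure (A.p i₀ x₀) (A.p i x)) ∧
      ∀ γ : Molino.GermHom S.closure (A.p i₀ x₀) (A.p i x),
        Function.Injective (S.conjHol i x γ) ∧
        Set.range (S.conjHol i x γ) = S.leafStabilizer (S.point i x γ) ∧
        S.EquivariantInclusion i x (S.point i x γ) (S.conjHol i x γ)) := by
  have h := fun (i : ι) (x : A.U i) (γ : Molino.GermHom S.closure (A.p i₀ x₀) (A.p i x)) =>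
    And.intro (S.conjHol_injective i x γ)
      (And.intro (S.range_conjHol γ) (S.equivariantInclusion γ))
  refine ⟨?_, fun i x => ⟨Molino.RegularAtlas.nonempty_germHom_closure hmin hequi hqa _ _, h i x⟩⟩
  -- For `γ = 1` conjugation is trivial, which turns the second item into the first.
  have h₀ := h i₀ x₀ 1
  rwa [S.conjHol_one] at h₀
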